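/- **Setting.** Let $N=\{1,\dots,T\}$ be a set of agents arriving in the known order $1,\dots,T$, let $M=(N,\mathcal I)$ be a matroid and $G=(N,E)$ a graph. A set $S\subseteq N$ is *feasible* if $S\in\mathcal I$ and no two agents of $S$ are adjacent in $G$. Agent $t$ has a real valuation $V_t$ with known distribution $F_t$ of finite mean. Let $d_1(M)=0$ if $\mathcal I=2^N$ and $d_1(M)=1$ otherwise, and let $d_2(G)=\max_{t\in N}\alpha\big(G[\{t'<t:\{t,t'\}\in E\}]\big)$, where $\alpha$ is the independence number. An *(ex-ante) prophet* consists of a joint distribution on $\mathbb R^T$ with marginals $F_1,\dots,F_T$ and a rule that selects a feasible set for each realization $(V_1,\dots,V_T)$; its welfare is the expected total valuation of the selected agents. Let $\mathrm{OPT}$ be the largest welfare of a prophet. An *online algorithm* sees $V_1,\dots,V_T$, now independent, one after another, decides on each agent $t$ irrevocably on the basis of $V_1,\dots,V_t$ alone, and always accepts a feasible set; its welfare is the expected total valuation of the accepted agents. **Theorem.** The maximum $\mathrm{OPT}$ is attained, and there is an online algorithm of welfare at least $$\frac{\mathrm{OPT}}{(d_1(M)+1)(d_2(G)+1)}.$$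 More precisely, take any prophet, of welfare $W$. Let $x_t$ be the probability that it selects $t$, let $y_t$ be the expected valuation of $t$ conditional on selection ($0$ if $x_t=0$), and define, for $t=T,T-1,\dots,1$, $$\pi_t=\sum_{t'>t:\,\{t,t'\}\in E}x_{t'}\max\{y_{t'}-\pi_{t'},0\}.$$ There is a random set $\hat I\in\mathcal I$ with $\Pr[t\in\hat I]=x_t$ for all $t$. For any such $\hat I$, put $\hat V_t=y_t-\pi_t$ if $t\in\hat I$ and $\hat V_t=-\pi_t$ otherwise, and for $Y\in\mathcal I$ let $$\hat R(Y)=\mathbb E\Big[\max_{S\subseteq N\setminus Y:\,S\cup Y\in\mathcal I}\ \sum_{t\in S}\hat V_t\Big],\qquad \tau(t\mid Y)=\frac{d_1(M)}{d_1(M)+1}\big(\hat R(Y)-\hat R(Y\cup\{t\})\big).$$ Then the algorithm that, having accepted $Y$, accepts agent $t$ if and only if $Y\cup\{t\}$ is feasible and $V_t\ge\tau(t\mid Y)+\pi_t$, is an online algorithm of welfare at least $\dfrac{W}{(d_1(M)+1)(d_2(G)+1)}$. -/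

import Mathlib

open MeasureTheory

noncomputable section

/-- A set of agents is feasible if it is independent both in the matroid and in the graph. -/
def Feasible {T : ℕ} (M : Matroid (Fin T)) (G : SimpleGraph (Fin T)) (S : Finset (Fin T)) : Prop :=
  M.Indep (S : Set (Fin T)) ∧ G.IsIndepSet (S : Set (Fin T))

open Classical in
/-- `d₁(M)`: `0` if every set of agents is independent in `M` (the free matroid), `1` otherwise. -/
def d₁ {T : ℕ} (M : Matroid (Fin T)) : ℕ :=
  if ∀ S : Set (Fin T), M.Indep S then 0 else 1

/-- `d₂(G)`: the maximum over agents `t` of the independence number of the subgraph induced by the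
neighbours of `t` that arrive before `t`. -/
def d₂ {T : ℕ} (G : SimpleGraph (Fin T)) : ℕ :=
  Finset.univ.sup fun t : Fin T => (G.induce {s : Fin T | s < t ∧ G.Adj t s}).indepNum

/-- An ex-ante prophet: a joint law of the valuations with the prescribed marginals `F t`, and a
measurable rule that selects a feasible set of agents on every realization. -/
structure Prophet {T : ℕ} (M : Matroid (Fin T)) (G : SimpleGraph (Fin T))
    (F : Fin T → Measure ℝ) where
  law : Measure (Fin T → ℝ)
  isProbabilityMeasure : IsProbabilityMeasure law
  marginal : ∀ t, law.map (fun v => v t) = F t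
  select : (Fin T → ℝ) → Finset (Fin T)
  measurable_select : ∀ t, MeasurableSet {v | t ∈ select v}
  feasible : ∀ v, Feasible M G (select v)

namespace Prophet

variable {T : ℕ} {M : Matroid (Fin T)} {G : SimpleGraph (Fin T)} {F : Fin T → Measure ℝ}

/-- The expected total valuation of the agents selected by the prophet. -/
def welfare (P : Prophet M G F) : ℝ :=
  ∫ v, ∑ t ∈ P.select v, v t ∂P.law

/-- The probability that the prophet selects agent `t`. -/
def x (P : Prophet M G F) (t : Fin T) : ℝ :=
  P.law.real {v | t ∈ P.select v}

/-- The expected valuation of agent `t` conditional on being selected by the prophet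
(`0` if she is selected with probability `0`). -/
def y (P : Prophet M G F) (t : Fin T) : ℝ :=
  (∫ v in {v | t ∈ P.select v}, v t ∂P.law) / P.x t

end Prophet

/-- The welfare of the ex-ante prophet, who chooses the joint law and the selection rule best. -/
def OPT {T : ℕ} (M : Matroid (Fin T)) (G : SimpleGraph (Fin T)) (F : Fin T → Measure ℝ) : ℝ :=
  sSup (Set.range (Prophet.welfare : Prophet M G F → ℝ))

/-- An online algorithm for agents arriving in the order of `Fin T`: for each valuation profile it
accepts a feasible set of agents, and whether it accepts `t` depends only on the valuations of the
agents up to and including `t`. -/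
structure OnlineAlgorithm {T : ℕ} (M : Matroid (Fin T)) (G : SimpleGraph (Fin T)) where
  select : (Fin T → ℝ) → Finset (Fin T)
  measurable_select : ∀ t, MeasurableSet {v | t ∈ select v}
  feasible : ∀ v, Feasible M G (select v)
  online : ∀ (t : Fin T) (v w : Fin T → ℝ), (∀ s ≤ t, v s = w s) → (t ∈ select v ↔ t ∈ select w)

/-- The expected welfare of an online algorithm, the valuations being independent with laws
`F t`. -/
def OnlineAlgorithm.welfare {T : ℕ} {M : Matroid (Fin T)} {G : SimpleGraph (Fin T)}
    (A : OnlineAlgorithm M G) (F : Fin T → Measure ℝ) : ℝ :=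
  ∫ v, ∑ t ∈ A.select v, v t ∂(Measure.pi F)

open Classical in
/-- The static graph prices, by backward induction over the agents:
`π t = ∑_{s > t, s adjacent to t} x s * max (y s - π s) 0`. -/
def graphPrice {T : ℕ} (G : SimpleGraph (Fin T)) (x y : Fin T → ℝ) (t : Fin T) : ℝ :=
  ∑ s : {s : Fin T // t < s ∧ G.Adj t s}, x s * max (y s - graphPrice G x y s) 0
termination_by T - t.val
decreasing_by exact Nat.sub_lt_sub_left t.isLt (Fin.lt_def.mp s.2.1)

/-- `q` is a probability distribution on the independent sets of `M` under which each agent `t`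
belongs to the random set with probability `x t`. -/
structure IsIndepLottery {T : ℕ} (M : Matroid (Fin T)) (x : Fin T → ℝ)
    (q : Finset (Fin T) → ℝ) : Prop where
  nonneg : ∀ I, 0 ≤ q I
  sum_eq_one : ∑ I, q I = 1
  indep : ∀ I, q I ≠ 0 → M.Indep (I : Set (Fin T))
  marginal : ∀ t, ∑ I with t ∈ I, q I = x t

/-- The residual of `Y`: the expected maximum, over sets `S` disjoint from `Y` with `S ∪ Y`
independent in the matroid, of the total reduced valuation of `S`. For a random set `I` with law
`q`, the reduced valuation of `t` is `y t - p t` if `t ∈ I` and `-p t` otherwise. It is only used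
for independent `Y`. -/
def matroidResidual {T : ℕ} (M : Matroid (Fin T)) (q : Finset (Fin T) → ℝ) (y p : Fin T → ℝ)
    (Y : Finset (Fin T)) : ℝ :=
  ∑ I : Finset (Fin T), q I *
    ⨆ S : {S : Finset (Fin T) // Disjoint S Y ∧ M.Indep ((S ∪ Y : Finset (Fin T)) : Set (Fin T))},
      ∑ t ∈ S.1, ((if t ∈ I then y t else 0) - p t)

/-- The balanced matroid threshold of agent `t` when `Y` has been accepted. The factor is `1 / 2`
if the matroid is not free, and `0` if it is free. -/
def matroidThreshold {T : ℕ} (M : Matroid (Fin T)) (q : Finset (Fin T) → ℝ) (y p : Fin T → ℝ)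
    (Y : Finset (Fin T)) (t : Fin T) : ℝ :=
  (d₁ M : ℝ) / (d₁ M + 1) * (matroidResidual M q y p Y - matroidResidual M q y p (insert t Y))

/-- The acceptance rule: with `Y` already accepted, agent `t` of valuation `a` is accepted iff this
is feasible and `a` is at least the matroid threshold plus the graph price. -/
def Accepts {T : ℕ} (M : Matroid (Fin T)) (G : SimpleGraph (Fin T)) (x y : Fin T → ℝ)
    (q : Finset (Fin T) → ℝ) (Y : Finset (Fin T)) (t : Fin T) (a : ℝ) : Prop :=
  Feasible M G (insert t Y) ∧
    matroidThreshold M q y (graphPrice G x y) Y t + graphPrice G x y t ≤ a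

open Classical in
/-- The set accepted by the threshold rule among the first `k` agents. -/
def thresholdRun {T : ℕ} (M : Matroid (Fin T)) (G : SimpleGraph (Fin T)) (x y : Fin T → ℝ)
    (q : Finset (Fin T) → ℝ) (v : Fin T → ℝ) : ℕ → Finset (Fin T)
  | 0 => ∅
  | k + 1 =>
    if h : k < T then
      if Accepts M G x y q (thresholdRun M G x y q v k) ⟨k, h⟩ (v ⟨k, h⟩) then
        insert ⟨k, h⟩ (thresholdRun M G x y q v k)
      else thresholdRun M G x y q v k
    else thresholdRun M G x y q v k

/-- The set of all agents accepted by the threshold rule. -/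
def thresholdSelect {T : ℕ} (M : Matroid (Fin T)) (G : SimpleGraph (Fin T)) (x y : Fin T → ℝ)
    (q : Finset (Fin T) → ℝ) (v : Fin T → ℝ) : Finset (Fin T) :=
  thresholdRun M G x y q v T

end

open ProbabilityTheory

/-! Posted-price argument. At history `Y`, an admissible agent faces the price c = τ(t | Y) + π_t,
and her accepted value splits as V·1[V ≥ c] = c·1[V ≥ c] + (V − c)⁺. The expected utility E(V − c)⁺
depends only on the marginal, and is at least x_t (y_t − c)⁺ because the prophet's law has the same
marginal (`Prophet.x_mul_max_le`). It therefore suffices to bound, for every valuation profile,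
payments plus these utility bounds (`sum_mul_max_le_sum_guaranteedValue`).

Let A be the accepted set and α = d₁/(d₁+1). The matroid payments telescope to α(R(∅) − R(A)). The
graph payments cover the surplus x_s (y_s − π_s)⁺ of every agent s blocked by an accepted neighbour,
so graph feasibility can then be ignored. In a non-free matroid, submodularity of maximum weight
under contraction gives the agents still admitted utility at least (1 − α) R(A). With α = 1/2 the
total is at least R(∅)/2, and R(∅) ≥ Σ x_t (y_t − π_t)⁺. In the free matroid the thresholds vanish
and the bound is immediate. Finally the graph prices lose at most a factor d₂ + 1
(`sum_mul_le_mul_sum_graphPrice`), since a prophet selects at most d₂ earlier neighbours of any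
agent.

For attainment, a prophet's welfare is at most the sum of the top-quantile integrals of mass x_t.
This bound is continuous in the lottery over feasible sets, which ranges over a compact set, and
every such lottery is matched by a prophet (`exists_prophet_ge_of_lottery`). -/

/-! ### Matroid exchange and submodularity of contraction values. -/

/-- Symmetric exchange between two bases. -/
theorem Matroid.IsBase.symmetric_exchange {α : Type*} {M : Matroid α} {B₁ B₂ : Set α} {a : α}
    (h₁ : M.IsBase B₁) (h₂ : M.IsBase B₂) (ha : a ∈ B₁) (ha' : a ∉ B₂) :
    ∃ b ∈ B₂, b ∉ B₁ ∧ M.IsBase (insert b (B₁ \ {a})) ∧ M.IsBase (insert a (B₂ \ {b})) := by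
  have haE : a ∈ M.E := h₁.subset_ground ha
  have hcl : a ∈ M.closure B₂ := by rw [h₂.closure_eq]; exact haE
  have hC := h₂.fundCircuit_isCircuit haE ha'
  have hsub := M.fundCircuit_subset_insert a B₂
  -- Otherwise the closure of `B₁ \ {a}` would contain the rest of the fundamental circuit, hence
  -- `a` itself.
  obtain ⟨b, hb, hb'⟩ : ∃ b ∈ M.fundCircuit a B₂ \ {a}, b ∉ M.closure (B₁ \ {a}) := by
    by_contra! hcon
    have h := M.closure_subset_closure_of_subset_closure (X := M.fundCircuit a B₂ \ {a}) hcon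
    exact h₁.indep.notMem_closure_sdiff_of_mem ha
      (h (hC.mem_closure_sdiff_singleton_of_mem (M.mem_fundCircuit a B₂)))
  have hb2 : b ∈ B₂ := (hsub hb.1).resolve_left hb.2
  have hba : b ≠ a := hb.2
  refine ⟨b, hb2, fun hb1 => hb' (M.mem_closure_of_mem' ⟨hb1, hb.2⟩ (h₁.subset_ground hb1)),
    h₁.exchange_base_of_notMem_closure ha hb' (h₂.subset_ground hb2), ?_⟩
  have hind := (h₂.indep.mem_fundCircuit_iff hcl ha').1 hb.1
  refine h₂.exchange_isBase_of_indep ha' (hind.subset ?_)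
  rintro x (rfl | hx)
  · exact ⟨Set.mem_insert _ _, hba.symm⟩
  · exact ⟨Set.mem_insert_of_mem _ hx.1, hx.2⟩

/-- Submodularity in exchange form: moving at most one element from `B` to `C` preserves total
weight. Extend both independent sets to bases `B'` and `X'`. If `a ∈ B'`, only `a` may have to move;
otherwise symmetric exchange of `a ∈ X'` supplies `b ∈ B'`, which moves when it lies in `B`. -/
theorem exists_contraction_exchange {α : Type*} [DecidableEq α] {M : Matroid α}
    {Y B C : Finset α} {a t : α} (w : α → ℝ) (hat : a ≠ t)
    (haY : a ∉ Y) (hB : Disjoint B Y) (hBi : M.Indep ((B ∪ Y : Finset α) : Set α))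
    (hC : Disjoint C (insert t (insert a Y)))
    (hCi : M.Indep ((C ∪ insert t (insert a Y) : Finset α) : Set α)) :
    ∃ D E : Finset α, Disjoint D (insert a Y) ∧
      M.Indep ((D ∪ insert a Y : Finset α) : Set α) ∧ Disjoint E (insert t Y) ∧
      M.Indep ((E ∪ insert t Y : Finset α) : Set α) ∧
      ∑ s ∈ D, w s + ∑ s ∈ E, w s = ∑ s ∈ B, w s + ∑ s ∈ C, w s := by
  obtain ⟨X', hX', hsX⟩ := hCi.exists_isBase_superset
  obtain ⟨B', hB', hsB⟩ := hBi.exists_isBase_superset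
  simp only [Finset.coe_union, Finset.coe_insert, Set.union_subset_iff, Set.insert_subset_iff]
    at hsX hsB
  obtain ⟨hCX, htX, haX, hYX⟩ := hsX
  obtain ⟨hBB, hYB⟩ := hsB
  have hCX' : ∀ x ∈ C, x ∈ X' := fun x hx => hCX hx
  have hYX' : ∀ x ∈ Y, x ∈ X' := fun x hx => hYX hx
  have hBB' : ∀ x ∈ B, x ∈ B' := fun x hx => hBB hx
  have hYB' : ∀ x ∈ Y, x ∈ B' := fun x hx => hYB hx
  simp only [Finset.disjoint_left, Finset.mem_insert, not_or] at hB hC ⊢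
  have key : ∀ b ∈ B, b ∉ C → ∑ s ∈ B.erase b, w s + ∑ s ∈ insert b C, w s =
      ∑ s ∈ B, w s + ∑ s ∈ C, w s := fun b hb hbC => by
    rw [Finset.sum_insert hbC, ← Finset.add_sum_erase B w hb]; ring
  by_cases ha : a ∈ B'
  · by_cases haB : a ∈ B
    · refine ⟨B.erase a, insert a C, by grind, hBi.subset ?_, by grind, hCi.subset ?_,
        key a haB (by grind)⟩
      · intro x hx; simp at hx ⊢; grind
      · intro x hx; simp at hx ⊢; grind
    · refine ⟨B, C, by grind, hB'.indep.subset ?_, by grind, hCi.subset ?_, rfl⟩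
      · intro x hx; simp at hx; grind
      · intro x hx; simp at hx ⊢; grind
  · obtain ⟨b, hb, hbX, h₁, h₂⟩ := hX'.symmetric_exchange hB' haX ha
    by_cases hbB : b ∈ B
    · refine ⟨B.erase b, insert b C, by grind, h₂.indep.subset ?_, by grind, h₁.indep.subset ?_,
        key b hbB (by grind)⟩
      · intro x hx; simp at hx ⊢; grind
      · intro x hx; simp at hx ⊢; grind
    · refine ⟨B, C, by grind, h₂.indep.subset ?_, by grind, hCi.subset ?_, rfl⟩
      · intro x hx; simp at hx ⊢; grind
      · intro x hx; simp at hx ⊢; grind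

/-- The maximum weight of a set whose union with `Y` is independent and disjoint. -/
noncomputable def contractionValue {α : Type*} [DecidableEq α] (M : Matroid α) (w : α → ℝ)
    (Y : Finset α) : ℝ :=
  ⨆ S : {S : Finset α // Disjoint S Y ∧ M.Indep ((S ∪ Y : Finset α) : Set α)}, ∑ t ∈ S.1, w t

section ContractionValue

variable {α : Type*} [DecidableEq α] [Finite α] {M : Matroid α} {w : α → ℝ} {A Y S : Finset α}

theorem sum_le_contractionValue (hd : Disjoint S Y)
    (hi : M.Indep ((S ∪ Y : Finset α) : Set α)) : ∑ t ∈ S, w t ≤ contractionValue M w Y := by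
  have := Fintype.ofFinite α
  exact le_ciSup (f := fun S : {S : Finset α // Disjoint S Y ∧
    M.Indep ((S ∪ Y : Finset α) : Set α)} => ∑ t ∈ S.1, w t)
    (Set.finite_range _).bddAbove ⟨S, hd, hi⟩

theorem exists_sum_eq_contractionValue (w : α → ℝ) (hY : M.Indep (Y : Set α)) :
    ∃ S : Finset α, Disjoint S Y ∧ M.Indep ((S ∪ Y : Finset α) : Set α) ∧
      ∑ t ∈ S, w t = contractionValue M w Y := by
  have := Fintype.ofFinite α
  have : Nonempty {S : Finset α // Disjoint S Y ∧ M.Indep ((S ∪ Y : Finset α) : Set α)} :=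
    ⟨⟨∅, by simp, by simpa using hY⟩⟩
  obtain ⟨S, hS⟩ := exists_eq_ciSup_of_finite (f := fun S : {S : Finset α // Disjoint S Y ∧
    M.Indep ((S ∪ Y : Finset α) : Set α)} => ∑ t ∈ S.1, w t)
  exact ⟨S.1, S.2.1, S.2.2, hS⟩

/-- Discarding elements of nonpositive weight keeps independence and loses nothing. Positivity later
forces an optimal set into the random set `I`. -/
theorem exists_pos_sum_eq_contractionValue (w : α → ℝ) (hY : M.Indep (Y : Set α)) :
    ∃ S : Finset α, Disjoint S Y ∧ M.Indep ((S ∪ Y : Finset α) : Set α) ∧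
      (∀ t ∈ S, 0 < w t) ∧ ∑ t ∈ S, w t = contractionValue M w Y := by
  obtain ⟨S, hd, hi, hS⟩ := exists_sum_eq_contractionValue w hY
  have hd' : Disjoint (S.filter (0 < w ·)) Y :=
    Finset.disjoint_of_subset_left (Finset.filter_subset _ _) hd
  have hi' : M.Indep ((S.filter (0 < w ·) ∪ Y : Finset α) : Set α) :=
    hi.subset (by exact_mod_cast Finset.union_subset_union_left (Finset.filter_subset _ _))
  refine ⟨_, hd', hi', fun t ht => (Finset.mem_filter.1 ht).2,
    le_antisymm (sum_le_contractionValue hd' hi') ?_⟩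
  rw [← hS, Finset.sum_filter]
  refine Finset.sum_le_sum fun t _ => ?_
  split_ifs with h
  · exact le_rfl
  · exact not_lt.1 h

theorem contractionValue_nonneg (w : α → ℝ) (hY : M.Indep (Y : Set α)) :
    0 ≤ contractionValue M w Y := by
  simpa using sum_le_contractionValue (M := M) (w := w) (S := ∅) (Y := Y) (by simp) (by simpa)

theorem contractionValue_insert_le (w : α → ℝ) {t : α}
    (hY : M.Indep ((insert t Y : Finset α) : Set α)) :
    contractionValue M w (insert t Y) ≤ contractionValue M w Y := by
  obtain ⟨S, hd, hi, hS⟩ := exists_sum_eq_contractionValue w hY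
  rw [← hS]
  refine sum_le_contractionValue
    (Finset.disjoint_of_subset_right (Finset.subset_insert _ _) hd) (hi.subset ?_)
  exact_mod_cast Finset.union_subset_union_right (Finset.subset_insert _ _)

theorem contractionValue_submodular (w : α → ℝ) {a t : α} (hat : a ≠ t) (haY : a ∉ Y)
    (hi : M.Indep ((insert t (insert a Y) : Finset α) : Set α)) :
    contractionValue M w Y + contractionValue M w (insert t (insert a Y)) ≤
      contractionValue M w (insert a Y) + contractionValue M w (insert t Y) := by
  have hY : M.Indep (Y : Set α) := hi.subset (by
    exact_mod_cast (Finset.subset_insert _ _).trans (Finset.subset_insert _ _))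
  obtain ⟨B, hB, hBi, hBs⟩ := exists_sum_eq_contractionValue w hY
  obtain ⟨C, hC, hCi, hCs⟩ := exists_sum_eq_contractionValue w hi
  obtain ⟨D, E, hD, hDi, hE, hEi, h⟩ := exists_contraction_exchange w hat haY hB hBi hC hCi
  rw [← hBs, ← hCs, ← h]
  exact add_le_add (sum_le_contractionValue hD hDi) (sum_le_contractionValue hE hEi)

/-- The loss in contraction value caused by adding an element grows with the contracted set. -/
theorem contractionValue_sub_insert_mono (w : α → ℝ) {t : α} (hYA : Y ⊆ A) (ht : t ∉ A)
    (hi : M.Indep ((insert t A : Finset α) : Set α)) :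
    contractionValue M w Y - contractionValue M w (insert t Y) ≤
      contractionValue M w A - contractionValue M w (insert t A) := by
  suffices h : ∀ Z : Finset α, t ∉ Z ∪ Y → M.Indep ((insert t (Z ∪ Y) : Finset α) : Set α) →
      contractionValue M w Y - contractionValue M w (insert t Y) ≤
        contractionValue M w (Z ∪ Y) - contractionValue M w (insert t (Z ∪ Y)) by
    have hA : A ∪ Y = A := Finset.union_eq_left.2 hYA
    simpa only [hA] using h A (by rwa [hA]) (by rwa [hA])
  intro Z
  induction Z using Finset.induction_on with
  | empty => intros; rw [Finset.empty_union]
  | insert a Z ha ih =>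
    intro ht' hi'
    rw [Finset.insert_union] at *
    by_cases haY : a ∈ Z ∪ Y
    · rw [Finset.insert_eq_of_mem haY] at *
      exact ih ht' hi'
    · rw [Finset.mem_insert, not_or] at ht'
      have h₁ := ih ht'.2 (hi'.subset (by
        exact_mod_cast Finset.insert_subset_insert _ (Finset.subset_insert _ _)))
      have h₂ := contractionValue_submodular w (Ne.symm ht'.1) haY hi'
      linarith

/-- Add `S` to `A` one element at a time. Each loss measured at `Z t` is at most the loss at the
larger current set; those telescope, and the final value is nonnegative. -/
theorem sum_sub_insert_le_contractionValue (w : α → ℝ) (Z : α → Finset α) (hZ : ∀ t, Z t ⊆ A)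
    (hd : Disjoint S A) (hi : M.Indep ((S ∪ A : Finset α) : Set α)) :
    ∑ t ∈ S, (contractionValue M w (Z t) - contractionValue M w (insert t (Z t))) ≤
      contractionValue M w A := by
  suffices h : ∑ t ∈ S, (contractionValue M w (Z t) - contractionValue M w (insert t (Z t))) ≤
      contractionValue M w A - contractionValue M w (S ∪ A) by
    linarith [contractionValue_nonneg w hi]
  induction S using Finset.induction_on with
  | empty => simp
  | insert s S hs ih =>
    rw [Finset.disjoint_insert_left] at hd
    rw [Finset.insert_union] at hi ⊢
    rw [Finset.sum_insert hs]
    have h₁ := ih hd.2 (hi.subset (by exact_mod_cast Finset.subset_insert _ _))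
    have h₂ := contractionValue_sub_insert_mono w ((hZ s).trans Finset.subset_union_right)
      (by simp [hs, hd.1]) hi
    linarith

end ContractionValue

/-! ### The run of the threshold rule. -/

section ThresholdRun

variable {T : ℕ} (M : Matroid (Fin T)) (G : SimpleGraph (Fin T)) (x y : Fin T → ℝ)
  (q : Finset (Fin T) → ℝ) (v : Fin T → ℝ)

open Classical in
theorem thresholdRun_succ (t : Fin T) : thresholdRun M G x y q v (t + 1) =
    if Accepts M G x y q (thresholdRun M G x y q v t) t (v t) then
      insert t (thresholdRun M G x y q v t) else thresholdRun M G x y q v t := by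
  rw [thresholdRun, dif_pos t.isLt]

theorem thresholdRun_subset_succ (k : ℕ) :
    thresholdRun M G x y q v k ⊆ thresholdRun M G x y q v (k + 1) := by
  rw [thresholdRun]
  split_ifs
  · exact Finset.subset_insert _ _
  · exact subset_rfl
  · exact subset_rfl

theorem thresholdRun_mono : Monotone (thresholdRun M G x y q v) :=
  monotone_nat_of_le_succ (thresholdRun_subset_succ M G x y q v)

theorem mem_thresholdRun_iff (k : ℕ) (t : Fin T) : t ∈ thresholdRun M G x y q v k ↔
    t.val < k ∧ Accepts M G x y q (thresholdRun M G x y q v t) t (v t) := by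
  induction k with
  | zero => simp [thresholdRun]
  | succ k ih =>
    rw [thresholdRun]
    split_ifs with h h'
    · rw [Finset.mem_insert, ih]
      constructor
      · rintro (rfl | h₁)
        · exact ⟨Nat.lt_succ_self _, h'⟩
        · exact ⟨h₁.1.trans (Nat.lt_succ_self _), h₁.2⟩
      · rintro ⟨h₁, h₂⟩
        rcases Nat.lt_succ_iff_lt_or_eq.1 h₁ with h₁ | h₁
        · exact Or.inr ⟨h₁, h₂⟩
        · exact Or.inl (Fin.ext h₁)
    · rw [ih]
      refine ⟨fun h₁ => ⟨h₁.1.trans (Nat.lt_succ_self _), h₁.2⟩, fun ⟨h₁, h₂⟩ => ⟨?_, h₂⟩⟩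
      rcases Nat.lt_succ_iff_lt_or_eq.1 h₁ with h₁ | h₁
      · exact h₁
      · subst h₁; exact absurd h₂ h'
    · rw [ih]
      exact and_congr_left fun _ => by omega

theorem mem_thresholdSelect_iff (t : Fin T) : t ∈ thresholdSelect M G x y q v ↔
    Accepts M G x y q (thresholdRun M G x y q v t) t (v t) := by
  rw [thresholdSelect, mem_thresholdRun_iff]
  exact and_iff_right t.isLt

theorem feasible_thresholdRun (k : ℕ) : Feasible M G (thresholdRun M G x y q v k) := by
  induction k with
  | zero => simp [thresholdRun, Feasible]
  | succ k ih =>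
    rw [thresholdRun]
    split_ifs with h h'
    · exact h'.1
    · exact ih
    · exact ih

variable {v} in
theorem thresholdRun_congr {w : Fin T → ℝ} {k : ℕ} (h : ∀ s : Fin T, s.val < k → v s = w s) :
    thresholdRun M G x y q v k = thresholdRun M G x y q w k := by
  induction k with
  | zero => rfl
  | succ k ih =>
    have ih := ih fun s hs => h s (hs.trans (Nat.lt_succ_self _))
    rw [thresholdRun, thresholdRun, ih]
    split_ifs with h₁ h₂ h₃ h₃
    · rfl
    · rw [h ⟨k, h₁⟩ (Nat.lt_succ_self _)] at h₂; exact absurd h₂ h₃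
    · rw [h ⟨k, h₁⟩ (Nat.lt_succ_self _)] at h₂; exact absurd h₃ h₂
    · rfl
    · rfl

/-- A rejected agent leaves the run unchanged, so only accepted agents contribute to the telescoping
sum. -/
theorem sum_thresholdSelect_sub_insert (R : Finset (Fin T) → ℝ) :
    ∑ t ∈ thresholdSelect M G x y q v, (R (thresholdRun M G x y q v t) -
      R (insert t (thresholdRun M G x y q v t))) = R ∅ - R (thresholdSelect M G x y q v) := by
  classical
  have h := Finset.sum_range_sub' (fun k => R (thresholdRun M G x y q v k)) T
  rw [← Fin.sum_univ_eq_sum_range (fun k => R (thresholdRun M G x y q v k) -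
    R (thresholdRun M G x y q v (k + 1))) T] at h
  rw [← Finset.sum_filter_add_sum_filter_not Finset.univ (· ∈ thresholdSelect M G x y q v)] at h
  change _ = R (thresholdRun M G x y q v 0) - R (thresholdRun M G x y q v T)
  rw [← h, Finset.filter_mem_eq_inter, Finset.univ_inter, Finset.sum_eq_zero (s := Finset.filter _ _),
    add_zero]
  · refine Finset.sum_congr rfl fun t ht => ?_
    rw [thresholdRun_succ, if_pos ((mem_thresholdSelect_iff M G x y q v t).1 ht)]
  · intro t ht
    rw [thresholdRun_succ, if_neg fun h =>
      (Finset.mem_filter.1 ht).2 ((mem_thresholdSelect_iff M G x y q v t).2 h), sub_self]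

end ThresholdRun

/-! ### Graph prices and charging. -/

section GraphPrice

variable {T : ℕ} {G : SimpleGraph (Fin T)} {x y : Fin T → ℝ}

open Classical in
theorem graphPrice_eq (G : SimpleGraph (Fin T)) (x y : Fin T → ℝ) (t : Fin T) :
    graphPrice G x y t =
      ∑ s with t < s ∧ G.Adj t s, x s * max (y s - graphPrice G x y s) 0 := by
  rw [graphPrice]
  symm
  exact Finset.sum_subtype _ (by simp) _

theorem graphPrice_nonneg (hx : ∀ t, 0 ≤ x t) (t : Fin T) : 0 ≤ graphPrice G x y t := by
  classical
  rw [graphPrice_eq]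
  exact Finset.sum_nonneg fun s _ => mul_nonneg (hx s) (le_max_right _ _)

open Classical in
/-- Exchanging the order of summation in a weighted sum of the graph prices. -/
theorem sum_mul_graphPrice (z : Fin T → ℝ) : ∑ t, z t * graphPrice G x y t =
    ∑ s, x s * max (y s - graphPrice G x y s) 0 * ∑ t with t < s ∧ G.Adj t s, z t := by
  have h : ∀ t, z t * graphPrice G x y t =
      ∑ s, if t < s ∧ G.Adj t s then x s * max (y s - graphPrice G x y s) 0 * z t else 0 := by
    intro t
    rw [graphPrice_eq, Finset.mul_sum, Finset.sum_filter]
    exact Finset.sum_congr rfl fun s _ => by rw [mul_comm (z t)]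
  rw [Finset.sum_congr rfl fun t _ => h t, Finset.sum_comm]
  refine Finset.sum_congr rfl fun s _ => ?_
  rw [Finset.mul_sum, Finset.sum_filter]

open Classical in
-- A blocked agent is charged to an accepted earlier neighbour, whose price contains her surplus as
-- a summand.
theorem sum_blocked_le_sum_graphPrice (hx : ∀ t, 0 ≤ x t) (A : Finset (Fin T)) :
    (∑ s with ∃ t ∈ A, t < s ∧ G.Adj t s, x s * max (y s - graphPrice G x y s) 0) ≤
      ∑ t ∈ A, graphPrice G x y t := by
  have h := sum_mul_graphPrice (G := G) (x := x) (y := y) fun t => if t ∈ A then 1 else 0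
  simp only [ite_mul, one_mul, zero_mul, Finset.sum_ite_mem, Finset.univ_inter] at h
  rw [h, Finset.sum_filter]
  refine Finset.sum_le_sum fun s _ => ?_
  have h0 : 0 ≤ x s * max (y s - graphPrice G x y s) 0 := mul_nonneg (hx s) (le_max_right _ _)
  split_ifs with hb
  · obtain ⟨t, htA, ht⟩ := hb
    refine le_mul_of_one_le_right h0 ?_
    have := Finset.single_le_sum (f := fun t => if t ∈ A then (1 : ℝ) else 0)
      (s := Finset.univ.filter fun t => t < s ∧ G.Adj t s) (fun i _ => by positivity)
      (Finset.mem_filter.2 ⟨Finset.mem_univ t, ht⟩)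
    simpa [htA] using this
  · exact mul_nonneg h0 (Finset.sum_nonneg fun i _ => by positivity)

open Classical in
-- Bound y by (y − π)⁺ + π. After exchanging sums, the π part counts the surplus of `s` with the
-- `x`-mass of her earlier neighbours, at most `d`.
theorem sum_mul_le_mul_sum_graphPrice {d : ℝ} (hx : ∀ t, 0 ≤ x t)
    (hd : ∀ s, ∑ t with t < s ∧ G.Adj t s, x t ≤ d) :
    ∑ t, x t * y t ≤ (d + 1) * ∑ t, x t * max (y t - graphPrice G x y t) 0 := by
  have h₁ : ∑ t, x t * y t ≤ ∑ t, x t * max (y t - graphPrice G x y t) 0 +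
      ∑ t, x t * graphPrice G x y t := by
    rw [← Finset.sum_add_distrib]
    refine Finset.sum_le_sum fun t _ => ?_
    rw [← mul_add]
    exact mul_le_mul_of_nonneg_left (by linarith [le_max_left (y t - graphPrice G x y t) 0]) (hx t)
  rw [sum_mul_graphPrice] at h₁
  have h₂ : ∑ s, x s * max (y s - graphPrice G x y s) 0 * ∑ t with t < s ∧ G.Adj t s, x t ≤
      d * ∑ t, x t * max (y t - graphPrice G x y t) 0 := by
    rw [Finset.mul_sum]
    refine Finset.sum_le_sum fun s _ => ?_
    rw [mul_comm d]
    exact mul_le_mul_of_nonneg_left (hd s) (mul_nonneg (hx s) (le_max_right _ _))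
  linarith

end GraphPrice

/-! ### The matroid residual. -/

section Residual

variable {T : ℕ} {M : Matroid (Fin T)} {x y p : Fin T → ℝ} {q : Finset (Fin T) → ℝ}

theorem matroidResidual_eq (M : Matroid (Fin T)) (q : Finset (Fin T) → ℝ) (y p : Fin T → ℝ)
    (Y : Finset (Fin T)) : matroidResidual M q y p Y =
      ∑ I, q I * contractionValue M (fun t => (if t ∈ I then y t else 0) - p t) Y := rfl

theorem matroidResidual_insert_le (hq : ∀ I, 0 ≤ q I) {Y : Finset (Fin T)} {t : Fin T}
    (hi : M.Indep ((insert t Y : Finset (Fin T)) : Set (Fin T))) :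
    matroidResidual M q y p (insert t Y) ≤ matroidResidual M q y p Y :=
  Finset.sum_le_sum fun I _ => mul_le_mul_of_nonneg_left (contractionValue_insert_le _ hi) (hq I)

theorem matroidThreshold_nonneg (hq : ∀ I, 0 ≤ q I) {Y : Finset (Fin T)} {t : Fin T}
    (hi : M.Indep ((insert t Y : Finset (Fin T)) : Set (Fin T))) :
    0 ≤ matroidThreshold M q y p Y t :=
  mul_nonneg (by positivity) (sub_nonneg.2 (matroidResidual_insert_le hq hi))

theorem sum_matroidResidual_sub_insert_le (hq : ∀ I, 0 ≤ q I) {A S : Finset (Fin T)}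
    (Z : Fin T → Finset (Fin T)) (hZ : ∀ t, Z t ⊆ A) (hd : Disjoint S A)
    (hi : M.Indep ((S ∪ A : Finset (Fin T)) : Set (Fin T))) :
    ∑ t ∈ S, (matroidResidual M q y p (Z t) - matroidResidual M q y p (insert t (Z t))) ≤
      matroidResidual M q y p A := by
  simp_rw [matroidResidual_eq, ← Finset.sum_sub_distrib, ← mul_sub]
  rw [Finset.sum_comm]
  refine Finset.sum_le_sum fun I _ => ?_
  rw [← Finset.mul_sum]
  exact mul_le_mul_of_nonneg_left (sum_sub_insert_le_contractionValue _ Z hZ hd hi) (hq I)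

theorem IsIndepLottery.sum_mul_eq (hq : IsIndepLottery M x q) (z : Fin T → ℝ) :
    ∑ t, x t * z t = ∑ I, q I * ∑ t ∈ I, z t := by
  simp_rw [← hq.marginal, Finset.sum_mul, Finset.sum_filter, Finset.mul_sum]
  rw [Finset.sum_comm]
  refine Finset.sum_congr rfl fun I _ => ?_
  rw [← Finset.sum_filter, Finset.filter_mem_eq_inter, Finset.univ_inter]

theorem IsIndepLottery.marginal_nonneg (hq : IsIndepLottery M x q) (t : Fin T) : 0 ≤ x t := by
  rw [← hq.marginal t]
  exact Finset.sum_nonneg fun I _ => hq.nonneg I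

theorem IsIndepLottery.sum_mul_max_le_matroidResidual (hq : IsIndepLottery M x q) :
    ∑ t, x t * max (y t - p t) 0 ≤ matroidResidual M q y p ∅ := by
  rw [hq.sum_mul_eq, matroidResidual_eq]
  refine Finset.sum_le_sum fun I _ => ?_
  rcases eq_or_ne (q I) 0 with h | h
  · simp [h]
  refine mul_le_mul_of_nonneg_left ?_ (hq.nonneg I)
  refine le_trans ?_ (sum_le_contractionValue (S := I.filter fun t => 0 < y t - p t) (by simp) ?_)
  · rw [Finset.sum_filter]
    refine Finset.sum_le_sum fun t ht => ?_
    rw [if_pos ht]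
    split_ifs with h
    · exact (max_eq_left h.le).le
    · exact (max_eq_right (not_lt.1 h)).le
  · rw [Finset.union_empty]
    exact (hq.indep I h).subset (by exact_mod_cast Finset.filter_subset _ _)

open Classical in
/-- The agents that the matroid still admits collect, above the thresholds, a constant fraction of
the residual. -/
theorem IsIndepLottery.mul_matroidResidual_le (hq : IsIndepLottery M x q) (hp : ∀ t, 0 ≤ p t)
    {A : Finset (Fin T)} (hA : M.Indep (A : Set (Fin T))) (Z : Fin T → Finset (Fin T))
    (hZ : ∀ t, Z t ⊆ A) :
    (1 - (d₁ M : ℝ) / (d₁ M + 1)) * matroidResidual M q y p A ≤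
      ∑ t, x t * (if M.Indep ((insert t (Z t) : Finset (Fin T)) : Set (Fin T)) then
        max (y t - p t - matroidThreshold M q y p (Z t) t) 0 else 0) := by
  rw [hq.sum_mul_eq]
  have hα : (0 : ℝ) ≤ (d₁ M : ℝ) / (d₁ M + 1) := by positivity
  set α : ℝ := (d₁ M : ℝ) / (d₁ M + 1)
  have hR : (1 - α) * matroidResidual M q y p A =
      ∑ I, q I * (contractionValue M (fun t => (if t ∈ I then y t else 0) - p t) A -
        α * matroidResidual M q y p A) := by
    simp_rw [mul_sub, Finset.sum_sub_distrib, ← Finset.sum_mul, hq.sum_eq_one,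
      ← matroidResidual_eq]
    ring
  rw [hR]
  refine Finset.sum_le_sum fun I _ => mul_le_mul_of_nonneg_left ?_ (hq.nonneg I)
  obtain ⟨S, hd, hi, hpos, hS⟩ := exists_pos_sum_eq_contractionValue
    (fun t => (if t ∈ I then y t else 0) - p t) hA
  -- Outside `I` the reduced valuation is `-p t ≤ 0`.
  have hSI : S ⊆ I := fun t ht => by
    by_contra h
    have := hpos t ht
    rw [if_neg h] at this
    linarith [hp t]
  have h₁ := sum_matroidResidual_sub_insert_le (y := y) (p := p) hq.nonneg Z hZ hd hi
  have h₂ : ∑ t ∈ S, (y t - p t - matroidThreshold M q y p (Z t) t) ≤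
      ∑ t ∈ I, (if M.Indep ((insert t (Z t) : Finset (Fin T)) : Set (Fin T)) then
        max (y t - p t - matroidThreshold M q y p (Z t) t) 0 else 0) := by
    refine le_trans (Finset.sum_le_sum fun t ht => ?_)
      (Finset.sum_le_sum_of_subset_of_nonneg hSI fun t _ _ => by split_ifs <;> simp)
    rw [if_pos (hi.subset ?_)]
    · exact le_max_left _ _
    · exact_mod_cast Finset.insert_subset (Finset.mem_union_left _ ht)
        ((hZ t).trans Finset.subset_union_right)
  refine le_trans ?_ h₂
  have h₃ : ∑ t ∈ S, matroidThreshold M q y p (Z t) t ≤ α * matroidResidual M q y p A := by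
    simp only [matroidThreshold]
    rw [← Finset.mul_sum]
    exact mul_le_mul_of_nonneg_left h₁ hα
  rw [← hS, Finset.sum_congr rfl fun t ht => by rw [if_pos (hSI ht)],
    Finset.sum_sub_distrib (fun t => y t - p t)]
  exact sub_le_sub_left h₃ _

end Residual

/-! ### The guarantee for each valuation profile. -/

section Pathwise

variable {T : ℕ} (M : Matroid (Fin T)) (G : SimpleGraph (Fin T)) (x y : Fin T → ℝ)
  (q : Finset (Fin T) → ℝ)

/-- The total price of agent `t` when `Y` has been accepted. -/
noncomputable def totalPrice (Y : Finset (Fin T)) (t : Fin T) : ℝ :=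
  matroidThreshold M q y (graphPrice G x y) Y t + graphPrice G x y t

open Classical in
/-- The price paid by agent `t` of valuation `a` when `Y` has been accepted, plus a lower bound on
her expected utility. -/
noncomputable def guaranteedValue (t : Fin T) (Y : Finset (Fin T)) (a : ℝ) : ℝ :=
  if Feasible M G (insert t Y) then
    (if totalPrice M G x y q Y t ≤ a then totalPrice M G x y q Y t else 0) +
      x t * max (y t - totalPrice M G x y q Y t) 0
  else 0

variable {M G x y q}

theorem sum_mul_max_le_sum_guaranteedValue (hq : IsIndepLottery M x q) (v : Fin T → ℝ) :
    (∑ t, x t * max (y t - graphPrice G x y t) 0) / ((d₁ M : ℝ) + 1) ≤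
      ∑ t, guaranteedValue M G x y q t (thresholdRun M G x y q v t) (v t) := by
  classical
  have hx := hq.marginal_nonneg
  set p := graphPrice G x y
  set Z := fun t : Fin T => thresholdRun M G x y q v t
  set A := thresholdSelect M G x y q v
  have hZA : ∀ t, Z t ⊆ A := fun t => thresholdRun_mono M G x y q v t.isLt.le
  have hp0 : ∀ t, 0 ≤ p t := graphPrice_nonneg hx
  have hpay : ∑ t, guaranteedValue M G x y q t (Z t) (v t) =
      ∑ t ∈ A, totalPrice M G x y q (Z t) t + ∑ t, if Feasible M G (insert t (Z t)) then
        x t * max (y t - totalPrice M G x y q (Z t) t) 0 else 0 := by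
    rw [← Finset.univ_inter A, ← Finset.sum_ite_mem, ← Finset.sum_add_distrib]
    refine Finset.sum_congr rfl fun t _ => ?_
    have hmem : t ∈ A ↔ Feasible M G (insert t (Z t)) ∧ totalPrice M G x y q (Z t) t ≤ v t :=
      mem_thresholdSelect_iff M G x y q v t
    unfold guaranteedValue
    clear_value A Z
    by_cases hf : Feasible M G (insert t (Z t)) <;>
      by_cases hc : totalPrice M G x y q (Z t) t ≤ v t <;> simp [hmem, hf, hc]
  have htel : ∑ t ∈ A, totalPrice M G x y q (Z t) t =
      (d₁ M : ℝ) / (d₁ M + 1) * (matroidResidual M q y p ∅ - matroidResidual M q y p A) +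
        ∑ t ∈ A, p t := by
    simp only [totalPrice, matroidThreshold]
    rw [Finset.sum_add_distrib, ← Finset.mul_sum,
      sum_thresholdSelect_sub_insert M G x y q v (matroidResidual M q y p)]
  have hblock := sum_blocked_le_sum_graphPrice (G := G) (y := y) hx A
  rw [Finset.sum_filter] at hblock
  have hfeas : ∑ t, x t * (if M.Indep ((insert t (Z t) : Finset (Fin T)) : Set (Fin T)) then
      max (y t - p t - matroidThreshold M q y p (Z t) t) 0 else 0) ≤
      (∑ s, if ∃ t ∈ A, t < s ∧ G.Adj t s then x s * max (y s - p s) 0 else 0) +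
      ∑ t, if Feasible M G (insert t (Z t)) then
        x t * max (y t - totalPrice M G x y q (Z t) t) 0 else 0 := by
    rw [← Finset.sum_add_distrib]
    refine Finset.sum_le_sum fun t _ => ?_
    have hnn : ∀ z : ℝ, 0 ≤ x t * max z 0 := fun z => mul_nonneg (hx t) (le_max_right _ _)
    by_cases hi : M.Indep ((insert t (Z t) : Finset (Fin T)) : Set (Fin T))
    · rw [if_pos hi]
      by_cases hf : Feasible M G (insert t (Z t))
      · rw [if_pos hf]
        have : y t - totalPrice M G x y q (Z t) t =
            y t - p t - matroidThreshold M q y p (Z t) t := by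
          rw [totalPrice]; ring
        rw [this]
        refine le_add_of_nonneg_left ?_
        split_ifs
        · exact hnn _
        · exact le_rfl
      -- Only the graph can exclude `t` here. The accepted neighbour's price covers her surplus over
      -- π, and lowering that by a nonnegative threshold only helps.
      · have hb : ∃ s ∈ A, s < t ∧ G.Adj s t := by
          by_contra! hcon
          refine hf ⟨hi, ?_⟩
          rw [Finset.coe_insert]
          refine Set.pairwise_insert.2 ⟨(feasible_thresholdRun M G x y q v t).2, fun s hs _ => ?_⟩
          rw [G.adj_comm s t, and_self]
          intro h
          exact hcon s (hZA t hs) (((mem_thresholdRun_iff M G x y q v t s).1 hs).1) h.symm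
        rw [if_neg hf, if_pos hb, add_zero]
        refine mul_le_mul_of_nonneg_left (max_le_max_right _ ?_) (hx t)
        linarith [matroidThreshold_nonneg (y := y) (p := p) hq.nonneg hi]
    · rw [if_neg hi, mul_zero]
      refine add_nonneg ?_ ?_ <;> split_ifs
      all_goals first | exact hnn _ | exact le_rfl
  rw [hpay, htel]
  suffices h : (∑ t, x t * max (y t - p t) 0) / ((d₁ M : ℝ) + 1) ≤
      (d₁ M : ℝ) / (d₁ M + 1) * (matroidResidual M q y p ∅ - matroidResidual M q y p A) +
      ∑ t, x t * (if M.Indep ((insert t (Z t) : Finset (Fin T)) : Set (Fin T)) then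
      max (y t - p t - matroidThreshold M q y p (Z t) t) 0 else 0) by
    linarith
  -- In the free case both sides are equal; passing through the residual of `A` would lose the
  -- weight of `A` itself.
  by_cases hfree : ∀ S : Set (Fin T), M.Indep S
  · have hd : d₁ M = 0 := if_pos hfree
    refine le_of_eq ?_
    simp [hd, hfree, matroidThreshold]
  · have hd : d₁ M = 1 := if_neg hfree
    have h₁ := hq.mul_matroidResidual_le (y := y) hp0
      (feasible_thresholdRun M G x y q v T).1 Z hZA
    have h₂ := hq.sum_mul_max_le_matroidResidual (y := y) (p := p)
    change _ * matroidResidual M q y p A ≤ _ at h₁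
    -- Now α = 1/2, and (R(∅) − R(A))/2 + R(A)/2 = R(∅)/2.
    rw [hd] at h₁ ⊢
    norm_num at h₁ ⊢
    linarith

end Pathwise

/-! ### The prophet as a lottery over feasible sets. -/

theorem measurableSet_eq_of_mem {Ω α : Type*} [MeasurableSpace Ω] [Finite α]
    {σ : Ω → Finset α} (h : ∀ t, MeasurableSet {v | t ∈ σ v}) (S : Finset α) :
    MeasurableSet {v | σ v = S} := by
  have : {v | σ v = S} = ⋂ t, {v | t ∈ σ v ↔ t ∈ S} := by
    ext v; simp [Finset.ext_iff]
  rw [this]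
  refine MeasurableSet.iInter fun t => ?_
  by_cases ht : t ∈ S
  · simpa [ht] using h t
  · simp only [ht, iff_false]
    exact (h t).compl

namespace Prophet

variable {T : ℕ} {M : Matroid (Fin T)} {G : SimpleGraph (Fin T)} {F : Fin T → Measure ℝ}
  (P : Prophet M G F)

/-- The probability that the prophet selects exactly the set `S`. -/
noncomputable def lottery (S : Finset (Fin T)) : ℝ := P.law.real {v | P.select v = S}

theorem measurableSet_select_eq (S : Finset (Fin T)) : MeasurableSet {v | P.select v = S} :=
  measurableSet_eq_of_mem P.measurable_select S

theorem lottery_nonneg (S : Finset (Fin T)) : 0 ≤ P.lottery S := measureReal_nonneg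

theorem sum_lottery_filter (p : Finset (Fin T) → Prop) [DecidablePred p] :
    ∑ S with p S, P.lottery S = P.law.real {v | p (P.select v)} := by
  have := P.isProbabilityMeasure
  have h : {v | p (P.select v)} = ⋃ S ∈ Finset.univ.filter p, {v | P.select v = S} := by
    ext v; simp
  rw [h, measureReal_biUnion_finset]
  · rfl
  · intro S _ S' _ hne
    exact Set.disjoint_left.2 fun v hv hv' => hne (hv.symm.trans hv')
  · exact fun S _ => P.measurableSet_select_eq S

theorem sum_lottery : ∑ S, P.lottery S = 1 := by
  have := P.isProbabilityMeasure
  have h := P.sum_lottery_filter fun _ => True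
  simpa using h

theorem lottery_marginal (t : Fin T) : ∑ S with t ∈ S, P.lottery S = P.x t :=
  P.sum_lottery_filter fun S => t ∈ S

theorem feasible_of_lottery_ne_zero {S : Finset (Fin T)} (hS : P.lottery S ≠ 0) :
    Feasible M G S := by
  by_contra h
  refine hS ?_
  have : {v | P.select v = S} = ∅ :=
    Set.eq_empty_iff_forall_notMem.2 fun v (hv : P.select v = S) => h (hv ▸ P.feasible v)
  rw [lottery, this, measureReal_empty]

theorem isIndepLottery : IsIndepLottery M P.x P.lottery where
  nonneg := P.lottery_nonneg
  sum_eq_one := P.sum_lottery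
  indep _ h := (P.feasible_of_lottery_ne_zero h).1
  marginal := P.lottery_marginal

theorem x_nonneg (t : Fin T) : 0 ≤ P.x t := measureReal_nonneg

variable (hint : ∀ t, Integrable (fun a : ℝ => a) (F t))
include hint

theorem integrable_eval (t : Fin T) : Integrable (fun v : Fin T → ℝ => v t) P.law := by
  have h := hint t
  rw [← P.marginal t] at h
  exact h.comp_measurable (measurable_pi_apply t)

omit hint in
theorem x_mul_y (t : Fin T) : P.x t * P.y t = ∫ v in {v | t ∈ P.select v}, v t ∂P.law := by
  have := P.isProbabilityMeasure
  rcases eq_or_ne (P.x t) 0 with h | h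
  · rw [h, zero_mul, Measure.restrict_eq_zero.2, integral_zero_measure]
    rwa [x, measureReal_eq_zero_iff] at h
  · rw [y, mul_div_cancel₀ _ h]

theorem welfare_eq : P.welfare = ∑ t, P.x t * P.y t := by
  simp_rw [x_mul_y, welfare]
  have h : ∀ v : Fin T → ℝ, ∑ t ∈ P.select v, v t =
      ∑ t, {v | t ∈ P.select v}.indicator (fun v : Fin T → ℝ => v t) v := by
    intro v
    simp [Set.indicator_apply, Finset.sum_ite_mem]
  simp_rw [h]
  rw [integral_finsetSum _ fun t _ =>
    (P.integrable_eval hint t).indicator (P.measurable_select t)]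
  exact Finset.sum_congr rfl fun t _ => integral_indicator (P.measurable_select t)

theorem setIntegral_sub_const (t : Fin T) (c : ℝ) :
    ∫ v in {v | t ∈ P.select v}, (v t - c) ∂P.law = P.x t * (P.y t - c) := by
  have := P.isProbabilityMeasure
  rw [integral_sub (P.integrable_eval hint t).integrableOn (integrable_const c), ← x_mul_y,
    setIntegral_const, smul_eq_mul, mul_sub]
  rfl

/-- Integrate V − c over the selection event and compare with (V − c)⁺ everywhere. The right side
sees only the marginal, which carries the bound over to independent valuations. -/
theorem x_mul_max_le (t : Fin T) (c : ℝ) :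
    P.x t * max (P.y t - c) 0 ≤ ∫ a, max (a - c) 0 ∂F t := by
  have := P.isProbabilityMeasure
  have hI : Integrable (fun v : Fin T → ℝ => max (v t - c) 0) P.law :=
    ((P.integrable_eval hint t).sub (integrable_const c)).pos_part
  rw [← P.marginal t, integral_map (measurable_pi_apply t).aemeasurable (by fun_prop),
    mul_max_of_nonneg _ _ (P.x_nonneg t),
    mul_zero]
  refine max_le ?_ (integral_nonneg fun v => le_max_right _ _)
  rw [← P.setIntegral_sub_const hint]
  refine le_trans ?_ (setIntegral_le_integral (s := {v | t ∈ P.select v}) hI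
    (ae_of_all _ fun v => le_max_right _ _))
  exact integral_mono ((P.integrable_eval hint t).sub (integrable_const c)).integrableOn
    hI.integrableOn fun v => le_max_left _ _

omit hint in
open Classical in
/-- The prophet selects, in expectation, at most `d₂ G` earlier neighbours of any agent. -/
theorem sum_x_earlier_neighbors_le (s : Fin T) :
    ∑ t with t < s ∧ G.Adj t s, P.x t ≤ d₂ G := by
  have h := P.isIndepLottery.sum_mul_eq fun t => if t < s ∧ G.Adj t s then 1 else 0
  simp only [mul_ite, mul_one, mul_zero, ← Finset.sum_filter] at h
  rw [h]
  calc _ ≤ ∑ S, P.lottery S * (d₂ G : ℝ) := ?_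
    _ = d₂ G := by rw [← Finset.sum_mul, P.sum_lottery, one_mul]
  refine Finset.sum_le_sum fun S _ => ?_
  rcases eq_or_ne (P.lottery S) 0 with h0 | h0
  · simp [h0]
  refine mul_le_mul_of_nonneg_left ?_ (P.lottery_nonneg S)
  have hS := (P.feasible_of_lottery_ne_zero h0).2
  rw [Finset.sum_const, nsmul_eq_mul, mul_one, Nat.cast_le]
  refine le_trans ?_ (Finset.le_sup (f := fun t : Fin T =>
    (G.induce {s : Fin T | s < t ∧ G.Adj t s}).indepNum) (Finset.mem_univ s))
  set K := (S.filter fun t => t < s ∧ G.Adj t s).subtype fun t => t ∈ {r | r < s ∧ G.Adj s r}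
    with hK
  have hcard : K.card = (S.filter fun t => t < s ∧ G.Adj t s).card := by
    rw [hK, Finset.card_subtype, Finset.filter_true_of_mem]
    intro t ht
    exact ⟨(Finset.mem_filter.1 ht).2.1, (Finset.mem_filter.1 ht).2.2.symm⟩
  rw [← hcard]
  refine SimpleGraph.IsIndepSet.card_le_indepNum ?_
  intro a ha b hb hab
  have ha' : a.1 ∈ S := (Finset.mem_filter.1 (Finset.mem_subtype.1 ha)).1
  have hb' : b.1 ∈ S := (Finset.mem_filter.1 (Finset.mem_subtype.1 hb)).1
  exact hS ha' hb' (Subtype.coe_ne_coe.2 hab)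

end Prophet

/-! ### Independence of the past and the welfare of the algorithm. -/

section Online

variable {T : ℕ} {F : Fin T → Measure ℝ} [∀ t, IsProbabilityMeasure (F t)]

/-- A statistic of the valuations of the agents before `t` is independent of the valuation of
`t`. -/
theorem integral_pi_of_earlier {t : Fin T} {σ : (Fin T → ℝ) → Finset (Fin T)}
    (hσ : ∀ s, MeasurableSet {v | s ∈ σ v})
    (hloc : ∀ v w : Fin T → ℝ, (∀ s < t, v s = w s) → σ v = σ w)
    {H : Finset (Fin T) → ℝ → ℝ} (hH : ∀ S, Integrable (H S) (F t)) :
    Integrable (fun v => H (σ v) (v t)) (Measure.pi F) ∧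
      ∫ v, H (σ v) (v t) ∂Measure.pi F =
        ∑ S, (Measure.pi F).real {v | σ v = S} * ∫ a, H S a ∂F t := by
  classical
  have hm := measurableSet_eq_of_mem hσ
  have heq : ∀ v, H (σ v) (v t) = ∑ S, {v | σ v = S}.indicator 1 v * H S (v t) := by
    intro v
    simp [Set.indicator_apply]
  have hmp := measurePreserving_eval F t
  have hHt : ∀ S, Integrable (fun v : Fin T → ℝ => H S (v t)) (Measure.pi F) := fun S =>
    hmp.integrable_comp_of_integrable (hH S)
  have hInd : ∀ S, IndepFun ({v | σ v = S}.indicator (1 : (Fin T → ℝ) → ℝ))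
      (fun v : Fin T → ℝ => v t) (Measure.pi F) := by
    intro S
    have h0 := (iIndepFun_pi (μ := F) (X := fun _ a => a) fun i => aemeasurable_id).indepFun_finset
      (Finset.univ.filter (· < t)) {t} (by simp) (fun i => measurable_pi_apply i)
    -- `e` extends the earlier valuations by `0`; by locality `σ` cannot see the difference.
    let e : ({s // s ∈ Finset.univ.filter (· < t)} → ℝ) → Fin T → ℝ :=
      fun u s => if h : s ∈ Finset.univ.filter (· < t) then u ⟨s, h⟩ else 0
    have he : Measurable e := by
      refine measurable_pi_iff.2 fun s => ?_
      by_cases h : s ∈ Finset.univ.filter (· < t)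
      · simp only [e, dif_pos h]; fun_prop
      · simp only [e, dif_neg h]; fun_prop
    have hψ : Measurable fun u : {s // s ∈ ({t} : Finset (Fin T))} → ℝ =>
        u ⟨t, Finset.mem_singleton_self t⟩ := measurable_pi_apply _
    have h1 := h0.comp (φ := fun u => {v | σ v = S}.indicator (1 : (Fin T → ℝ) → ℝ) (e u))
      ((measurable_one.indicator (hm S)).comp he) hψ
    convert h1 using 1
    · funext v
      have : σ (e fun i => v i) = σ v := hloc _ _ fun s hs => by simp [e, hs]
      simp [Set.indicator_apply, this]
    · rfl
  have hI : ∀ S, Integrable (fun v : Fin T → ℝ => {v | σ v = S}.indicator 1 v * H S (v t))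
      (Measure.pi F) := by
    intro S
    refine ((hHt S).indicator (hm S)).congr (ae_of_all _ fun v => ?_)
    by_cases h : σ v = S <;> simp [h]
  simp_rw [heq]
  refine ⟨integrable_finsetSum _ fun S _ => hI S, ?_⟩
  rw [integral_finsetSum _ fun S _ => hI S]
  refine Finset.sum_congr rfl fun S _ => ?_
  have hmap : ∫ v, H S (v t) ∂Measure.pi F = ∫ a, H S a ∂F t := by
    rw [← hmp.map_eq, integral_map hmp.measurable.aemeasurable]
    rw [hmp.map_eq]; exact (hH S).aestronglyMeasurable
  rw [← hmap, ← integral_indicator_one (hm S)]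
  have hmeas : AEStronglyMeasurable (H S)
      (Measure.map (fun v : Fin T → ℝ => v t) (Measure.pi F)) := by
    rw [show Measure.map (fun v : Fin T → ℝ => v t) (Measure.pi F) = F t from hmp.map_eq]
    exact (hH S).aestronglyMeasurable
  exact (hInd S).integral_fun_comp_mul_comp (f := fun a => a) (g := H S)
    (measurable_one.indicator (hm S)).aemeasurable (measurable_pi_apply t).aemeasurable
    (by fun_prop) hmeas

end Online

section Threshold

variable {T : ℕ} (M : Matroid (Fin T)) (G : SimpleGraph (Fin T)) (x y : Fin T → ℝ)
  (q : Finset (Fin T) → ℝ)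

theorem accepts_iff (Y : Finset (Fin T)) (t : Fin T) (a : ℝ) : Accepts M G x y q Y t a ↔
    Feasible M G (insert t Y) ∧ totalPrice M G x y q Y t ≤ a := Iff.rfl

theorem measurableSet_accepts (Y : Finset (Fin T)) (t : Fin T) :
    MeasurableSet {a | Accepts M G x y q Y t a} := by
  simp only [accepts_iff]
  exact (MeasurableSet.const _).inter measurableSet_Ici

theorem measurableSet_mem_thresholdRun (k : ℕ) (t : Fin T) :
    MeasurableSet {v | t ∈ thresholdRun M G x y q v k} := by
  induction k using Nat.strong_induction_on generalizing t with
  | _ k ih =>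
    simp only [mem_thresholdRun_iff]
    by_cases htk : t.val < k
    · have h : {v : Fin T → ℝ | t.val < k ∧ Accepts M G x y q (thresholdRun M G x y q v t) t (v t)} =
          ⋃ Y, {v | thresholdRun M G x y q v t = Y} ∩
            {v : Fin T → ℝ | Accepts M G x y q Y t (v t)} := by
        ext v; simp [htk]
      rw [h]
      refine MeasurableSet.iUnion fun Y => MeasurableSet.inter ?_ ?_
      · exact measurableSet_eq_of_mem (fun s => ih t htk s) Y
      · exact (measurableSet_accepts M G x y q Y t).preimage (measurable_pi_apply t)
    · simp [htk]

/-- The threshold rule as an online algorithm. -/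
noncomputable def thresholdAlgorithm : OnlineAlgorithm M G where
  select := thresholdSelect M G x y q
  measurable_select := measurableSet_mem_thresholdRun M G x y q T
  feasible v := feasible_thresholdRun M G x y q v T
  online t v w h := by
    rw [mem_thresholdSelect_iff, mem_thresholdSelect_iff, h t le_rfl,
      thresholdRun_congr M G x y q fun s hs => h s (Fin.le_def.2 hs.le)]

variable {M G q} {F : Fin T → Measure ℝ}

theorem integrable_ite_le {μ : Measure ℝ} (hμ : Integrable (fun a : ℝ => a) μ) (c : ℝ) :
    Integrable (fun a : ℝ => if c ≤ a then a else 0) μ :=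
  (hμ.indicator (s := Set.Ici c) measurableSet_Ici).congr
    (ae_of_all _ fun a => by simp [Set.indicator_apply])

theorem integrable_ite_le_const (μ : Measure ℝ) [IsFiniteMeasure μ] (c b : ℝ) :
    Integrable (fun a : ℝ => if c ≤ a then b else 0) μ :=
  ((integrable_const b).indicator (s := Set.Ici c) measurableSet_Ici).congr
    (ae_of_all _ fun a => by simp [Set.indicator_apply])

open Classical in
theorem integrable_accepted_value (hint : ∀ t, Integrable (fun a : ℝ => a) (F t)) (t : Fin T)
    (Y : Finset (Fin T)) :
    Integrable (fun a => if Accepts M G x y q Y t a then a else 0) (F t) := by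
  simp only [accepts_iff]
  by_cases h : Feasible M G (insert t Y)
  · simpa [h] using integrable_ite_le (hint t) _
  · simp [h]

theorem integrable_guaranteedValue [∀ t, IsProbabilityMeasure (F t)] (t : Fin T)
    (Y : Finset (Fin T)) : Integrable (guaranteedValue M G x y q t Y) (F t) := by
  unfold guaranteedValue
  by_cases h : Feasible M G (insert t Y)
  · simp only [h, if_true]
    exact (integrable_ite_le_const _ _ _).add (integrable_const _)
  · simp [h]

open Classical in
theorem Prophet.integral_guaranteedValue_le (P : Prophet M G F)
    [∀ t, IsProbabilityMeasure (F t)]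
    (hint : ∀ t, Integrable (fun a : ℝ => a) (F t)) (t : Fin T) (Y : Finset (Fin T)) :
    ∫ a, guaranteedValue M G P.x P.y q t Y a ∂F t ≤
      ∫ a, (if Accepts M G P.x P.y q Y t a then a else 0) ∂F t := by
  unfold guaranteedValue
  simp only [accepts_iff]
  by_cases h : Feasible M G (insert t Y)
  · simp only [h, if_true, true_and]
    set c := totalPrice M G P.x P.y q Y t
    have hmax : Integrable (fun a : ℝ => max (a - c) 0) (F t) :=
      ((hint t).sub (integrable_const c)).pos_part
    have heq : ∀ a : ℝ, (if c ≤ a then a else 0) = (if c ≤ a then c else 0) + max (a - c) 0 := by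
      intro a
      split_ifs with hc
      · rw [max_eq_left (sub_nonneg.2 hc)]; ring
      · rw [max_eq_right (sub_nonpos.2 (not_le.1 hc).le), add_zero]
    simp_rw [heq]
    rw [integral_add (integrable_ite_le_const _ _ _) (integrable_const _),
      integral_add (integrable_ite_le_const _ _ _) hmax]
    simpa using P.x_mul_max_le hint t c
  · simp [h]

theorem Prophet.le_welfare_thresholdAlgorithm (P : Prophet M G F)
    [∀ t, IsProbabilityMeasure (F t)]
    (hint : ∀ t, Integrable (fun a : ℝ => a) (F t)) (hq : IsIndepLottery M P.x q) :
    P.welfare / (((d₁ M : ℝ) + 1) * ((d₂ G : ℝ) + 1)) ≤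
      (thresholdAlgorithm M G P.x P.y q).welfare F := by
  classical
  have h₁ := fun t => integral_pi_of_earlier (F := F) (t := t)
    (measurableSet_mem_thresholdRun M G P.x P.y q t)
    (fun v w h => thresholdRun_congr M G P.x P.y q h)
    (integrable_accepted_value (M := M) (G := G) (q := q) P.x P.y hint t)
  have h₂ := fun t => integral_pi_of_earlier (F := F) (t := t)
    (measurableSet_mem_thresholdRun M G P.x P.y q t)
    (fun v w h => thresholdRun_congr M G P.x P.y q h)
    (integrable_guaranteedValue (M := M) (G := G) (q := q) P.x P.y t)
  have hwelfare : (thresholdAlgorithm M G P.x P.y q).welfare F = ∑ t : Fin T, ∫ v,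
      (if Accepts M G P.x P.y q (thresholdRun M G P.x P.y q v t) t (v t) then v t else 0)
        ∂Measure.pi F := by
    rw [← integral_finsetSum _ fun t _ => (h₁ t).1]
    refine integral_congr_ae (ae_of_all _ fun v => ?_)
    simp only [← mem_thresholdSelect_iff, Finset.sum_ite_mem, Finset.univ_inter]
    rfl
  have hgraph := sum_mul_le_mul_sum_graphPrice (y := P.y) P.x_nonneg P.sum_x_earlier_neighbors_le
  rw [← P.welfare_eq hint] at hgraph
  calc P.welfare / (((d₁ M : ℝ) + 1) * ((d₂ G : ℝ) + 1))
      ≤ (∑ t, P.x t * max (P.y t - graphPrice G P.x P.y t) 0) / ((d₁ M : ℝ) + 1) := by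
        rw [mul_comm, ← div_div]
        exact div_le_div_of_nonneg_right ((div_le_iff₀' (by positivity)).2 hgraph) (by positivity)
    _ ≤ ∫ v, ∑ t : Fin T, guaranteedValue M G P.x P.y q t (thresholdRun M G P.x P.y q v t) (v t)
        ∂Measure.pi F := by
        have h := integral_mono (μ := Measure.pi F) (integrable_const _)
          (integrable_finsetSum Finset.univ fun t _ => (h₂ t).1)
          (sum_mul_max_le_sum_guaranteedValue hq)
        simpa using h
    _ ≤ _ := by
        rw [hwelfare, integral_finsetSum _ fun t _ => (h₂ t).1]
        refine Finset.sum_le_sum fun t _ => ?_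
        rw [(h₁ t).2, (h₂ t).2]
        exact Finset.sum_le_sum fun Y _ => mul_le_mul_of_nonneg_left
          (P.integral_guaranteedValue_le hint t Y) measureReal_nonneg

end Threshold

/-! ### Quantiles and an upper bound on every prophet. -/

/-- The quantile function of a probability measure on `ℝ`, extended by `0` outside `(0, 1)`. -/
noncomputable def quantile (μ : Measure ℝ) : ℝ → ℝ :=
  (Set.Ioo 0 1).indicator fun u => sInf {a | u ≤ cdf μ a}

/-- Right continuity of the cdf puts the infimum itself in the set. -/
theorem quantile_le_iff {μ : Measure ℝ} {u : ℝ} (hu : u ∈ Set.Ioo (0 : ℝ) 1) (a : ℝ) :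
    quantile μ u ≤ a ↔ u ≤ cdf μ a := by
  rw [quantile, Set.indicator_of_mem hu]
  have hne : {a | u ≤ cdf μ a}.Nonempty :=
    (((tendsto_cdf_atTop μ).eventually (lt_mem_nhds hu.2)).exists).imp fun _ h => h.le
  have hbdd : BddBelow {a | u ≤ cdf μ a} := by
    obtain ⟨b, hb⟩ := ((tendsto_cdf_atBot μ).eventually (gt_mem_nhds hu.1)).exists
    refine ⟨b, fun a ha => ?_⟩
    by_contra! hab
    exact absurd ((ha.trans (monotone_cdf μ hab.le)).trans_lt hb) (lt_irrefl u)
  refine ⟨fun h => ?_, fun h => csInf_le hbdd h⟩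
  refine le_trans ?_ (monotone_cdf μ h)
  have hc : Filter.Tendsto (cdf μ) (nhdsWithin (sInf {a | u ≤ cdf μ a}) (Set.Ioi _))
      (nhds (cdf μ (sInf {a | u ≤ cdf μ a}))) :=
    ((cdf μ).right_continuous _).mono_left (nhdsWithin_mono _ Set.Ioi_subset_Ici_self)
  refine ge_of_tendsto hc (Filter.eventually_of_mem self_mem_nhdsWithin fun b hb => ?_)
  obtain ⟨a, ha, hab⟩ := exists_lt_of_csInf_lt hne hb
  exact le_trans ha (monotone_cdf μ hab.le)

section Quantile

variable {μ : Measure ℝ} [IsProbabilityMeasure μ]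

theorem monotoneOn_quantile (μ : Measure ℝ) [IsProbabilityMeasure μ] :
    MonotoneOn (quantile μ) (Set.Ioo 0 1) := fun _ hu _ hv huv =>
  (quantile_le_iff hu _).2 (huv.trans ((quantile_le_iff hv _).1 le_rfl))

theorem measurable_quantile (μ : Measure ℝ) [IsProbabilityMeasure μ] :
    Measurable (quantile μ) := by
  refine measurable_of_Iic fun a => ?_
  have : quantile μ ⁻¹' Set.Iic a =
      (Set.Ioo 0 1 ∩ Set.Iic (cdf μ a)) ∪ ((Set.Ioo (0 : ℝ) 1)ᶜ ∩ {_u | 0 ≤ a}) := by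
    ext u
    by_cases hu : u ∈ Set.Ioo (0 : ℝ) 1
    · simp only [Set.mem_preimage, Set.mem_Iic, quantile_le_iff hu, Set.mem_union, Set.mem_inter_iff,
        Set.mem_compl_iff, hu, not_true, false_and, or_false, true_and]
    · have h0 : quantile μ u = 0 := Set.indicator_of_notMem hu _
      simp only [Set.mem_preimage, Set.mem_Iic, h0, Set.mem_union, Set.mem_inter_iff,
        Set.mem_compl_iff, hu, not_false_iff, false_and, false_or, true_and]
      rfl
  rw [this]
  exact (measurableSet_Ioo.inter measurableSet_Iic).union
    (measurableSet_Ioo.compl.inter (MeasurableSet.const _))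

theorem map_quantile (μ : Measure ℝ) [IsProbabilityMeasure μ] :
    (volume.restrict (Set.Ioc 0 1)).map (quantile μ) = μ := by
  refine Measure.ext_of_Iic _ _ fun a => ?_
  rw [Measure.map_apply (measurable_quantile μ) measurableSet_Iic,
    Measure.restrict_apply (measurable_quantile μ measurableSet_Iic), ← ofReal_cdf]
  have h1 := cdf_le_one μ a
  refine le_antisymm ?_ ?_
  · calc _ ≤ volume (Set.Ioc 0 (cdf μ a) ∪ {1}) := measure_mono ?_
      _ ≤ volume (Set.Ioc 0 (cdf μ a)) + volume {(1 : ℝ)} := measure_union_le _ _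
      _ = _ := by simp
    rintro u ⟨hu, hu0, hu1⟩
    rcases hu1.lt_or_eq with hu1 | hu1
    · exact Or.inl ⟨hu0, (quantile_le_iff ⟨hu0, hu1⟩ a).1 hu⟩
    · exact Or.inr hu1
  · calc _ = volume (Set.Ioo 0 (cdf μ a)) := by simp
      _ ≤ _ := by
        refine measure_mono fun u hu => ?_
        exact ⟨(quantile_le_iff ⟨hu.1, hu.2.trans_le h1⟩ a).2 hu.2.le, hu.1, (hu.2.trans_le h1).le⟩

theorem integral_eq_integral_quantile {f : ℝ → ℝ} (hf : Measurable f) :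
    ∫ a, f a ∂μ = ∫ u in (0 : ℝ)..1, f (quantile μ u) := by
  rw [intervalIntegral.integral_of_le zero_le_one]
  conv_lhs => rw [← map_quantile μ]
  exact integral_map (measurable_quantile μ).aemeasurable hf.aestronglyMeasurable

/-- The default value `0` outside (0, 1) makes the quantile function integrable on the whole line,
so that its primitive is continuous everywhere. -/
theorem integrable_quantile (hμ : Integrable (fun a : ℝ => a) μ) : Integrable (quantile μ) := by
  rw [← map_quantile μ] at hμ
  have h : IntegrableOn (quantile μ) (Set.Ioc 0 1) := hμ.comp_measurable (measurable_quantile μ)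
  have hsub : Function.support (quantile μ) ⊆ Set.Ioc 0 1 :=
    Set.support_indicator_subset.trans Set.Ioo_subset_Ioc_self
  exact (integrableOn_iff_integrable_of_support_subset hsub).1 h

/-- The expected excess over the `(1 - p)`-quantile, as an integral over the top quantiles. -/
theorem integral_max_sub_quantile (hμ : Integrable (fun a : ℝ => a) μ) {p : ℝ}
    (hp : p ∈ Set.Ioo (0 : ℝ) 1) :
    ∫ a, max (a - quantile μ (1 - p)) 0 ∂μ =
      (∫ u in (1 - p)..1, quantile μ u) - p * quantile μ (1 - p) := by
  have hQ := integrable_quantile hμ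
  set c := quantile μ (1 - p)
  have hp' : 1 - p ∈ Set.Ioo (0 : ℝ) 1 := ⟨by linarith [hp.2], by linarith [hp.1]⟩
  have hI : ∀ a b : ℝ, IntervalIntegrable (fun u => max (quantile μ u - c) 0) volume a b :=
    fun a b => by
      have h := hQ.intervalIntegrable.sub (intervalIntegrable_const (c := c) (a := a) (b := b))
      exact ⟨h.1.pos_part, h.2.pos_part⟩
  rw [integral_eq_integral_quantile (by fun_prop),
    ← intervalIntegral.integral_add_adjacent_intervals (hI 0 (1 - p)) (hI (1 - p) 1)]
  have h₁ : ∫ u in (0 : ℝ)..(1 - p), max (quantile μ u - c) 0 = 0 := by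
    rw [intervalIntegral.integral_congr_ae (g := fun _ => 0), intervalIntegral.integral_zero]
    refine ae_of_all _ fun u hu => ?_
    rw [Set.uIoc_of_le hp'.1.le] at hu
    exact max_eq_right (sub_nonpos.2 (monotoneOn_quantile μ ⟨hu.1, hu.2.trans_lt hp'.2⟩ hp' hu.2))
  have h₂ : ∫ u in (1 - p)..1, max (quantile μ u - c) 0 = ∫ u in (1 - p)..1, (quantile μ u - c) := by
    refine intervalIntegral.integral_congr_Ioo_of_le hp'.2.le fun u hu => ?_
    exact max_eq_left (sub_nonneg.2
      (monotoneOn_quantile μ hp' ⟨hp'.1.trans hu.1, hu.2⟩ hu.1.le))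
  rw [h₁, h₂, zero_add, intervalIntegral.integral_sub hQ.intervalIntegrable intervalIntegrable_const,
    intervalIntegral.integral_const]
  simp

theorem smul_map_affine_restrict_Ioc (a : ℝ) {b : ℝ} (hb : 0 ≤ b) :
    ENNReal.ofReal b • (volume.restrict (Set.Ioc (0 : ℝ) 1)).map (fun u => a + b * u) =
      volume.restrict (Set.Ioc a (a + b)) := by
  rcases hb.eq_or_lt with rfl | hb
  · simp
  have hpre : (fun u => a + b * u) ⁻¹' Set.Ioc a (a + b) = Set.Ioc 0 1 := by
    ext u
    simp only [Set.mem_preimage, Set.mem_Ioc, lt_add_iff_pos_right, add_le_add_iff_left]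
    exact and_congr (mul_pos_iff_of_pos_left hb) (mul_le_iff_le_one_right hb)
  have hmap : ENNReal.ofReal b • (volume : Measure ℝ).map (fun u => a + b * u) = volume := by
    have h := Real.smul_map_volume_mul_left hb.ne'
    rw [abs_of_pos hb] at h
    have h' := congrArg (Measure.map (a + ·)) h
    rw [Measure.map_smul, Measure.map_map (by fun_prop) (by fun_prop),
      map_add_left_eq_self] at h'
    exact h'
  rw [← hpre, ← Measure.restrict_map (by fun_prop) measurableSet_Ioc, ← Measure.restrict_smul, hmap]

end Quantile

/-- Take c to be the (1 − x)-quantile in x(y − c) ≤ E(V − c)⁺; the terms xc cancel. The cases x = 0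
and x = 1 are separate because `quantile` has only its default value at the endpoints. -/
theorem Prophet.x_mul_y_le {T : ℕ} {M : Matroid (Fin T)} {G : SimpleGraph (Fin T)}
    {F : Fin T → Measure ℝ} (P : Prophet M G F) [∀ t, IsProbabilityMeasure (F t)]
    (hint : ∀ t, Integrable (fun a : ℝ => a) (F t)) (t : Fin T) :
    P.x t * P.y t ≤ ∫ u in (1 - P.x t)..1, quantile (F t) u := by
  have := P.isProbabilityMeasure
  rcases (P.x_nonneg t).eq_or_lt with h0 | h0
  · simp [← h0]
  have h1 : P.x t ≤ 1 := measureReal_le_one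
  rcases h1.eq_or_lt with h1 | h1
  · rw [P.x_mul_y, h1, sub_self, ← integral_eq_integral_quantile (f := fun a => a) (by fun_prop),
      Measure.restrict_eq_self_of_ae_mem, ← P.marginal t,
      integral_map (measurable_pi_apply t).aemeasurable (by fun_prop)]
    have h := (ofReal_measureReal (μ := P.law) (s := {v | t ∈ P.select v})).symm
    rw [show P.law.real {v | t ∈ P.select v} = 1 from h1, ENNReal.ofReal_one] at h
    exact (mem_ae_iff_prob_eq_one (P.measurable_select t)).2 h
  · have h := P.x_mul_max_le hint t (quantile (F t) (1 - P.x t))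
    rw [integral_max_sub_quantile (hint t) ⟨h0, h1⟩] at h
    have := (mul_le_mul_of_nonneg_left (le_max_left _ 0) h0.le).trans h
    linarith [mul_sub (P.x t) (P.y t) (quantile (F t) (1 - P.x t))]

/-! ### Constructing an optimal prophet. -/

theorem feasible_empty {T : ℕ} (M : Matroid (Fin T)) (G : SimpleGraph (Fin T)) :
    Feasible M G ∅ := by
  simp [Feasible]

theorem measurable_sum_of_measurableSet_mem {T : ℕ} {σ : (Fin T → ℝ) → Finset (Fin T)}
    (hσ : ∀ t, MeasurableSet {v | t ∈ σ v}) : Measurable fun v => ∑ t ∈ σ v, v t := by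
  have h : (fun v : Fin T → ℝ => ∑ t ∈ σ v, v t) =
      fun v => ∑ t, {v | t ∈ σ v}.indicator (fun v : Fin T → ℝ => v t) v := by
    funext v
    simp [Set.indicator_apply, Finset.sum_ite_mem]
  rw [h]
  exact Finset.measurable_sum _ fun t _ => (measurable_pi_apply t).indicator (hσ t)

/-- A set of maximum total valuation among finitely many candidates can be selected measurably. -/
theorem exists_measurable_argmax {T : ℕ} {s : Finset (Finset (Fin T))} (hs : s.Nonempty) :
    ∃ σ : (Fin T → ℝ) → Finset (Fin T), (∀ t, MeasurableSet {v | t ∈ σ v}) ∧ (∀ v, σ v ∈ s) ∧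
      ∀ v, ∀ S ∈ s, ∑ t ∈ S, v t ≤ ∑ t ∈ σ v, v t := by
  classical
  induction hs using Finset.Nonempty.cons_induction with
  | singleton a => exact ⟨fun _ => a, fun t => MeasurableSet.const _, by simp, by simp⟩
  | cons a s ha hs ih =>
    obtain ⟨σ, hσ, hmem, hmax⟩ := ih
    have hB : MeasurableSet {v : Fin T → ℝ | ∑ t ∈ σ v, v t ≤ ∑ t ∈ a, v t} :=
      measurableSet_le (measurable_sum_of_measurableSet_mem hσ) (by fun_prop)
    refine ⟨fun v => if ∑ t ∈ σ v, v t ≤ ∑ t ∈ a, v t then a else σ v, fun t => ?_, fun v => ?_,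
      fun v S hS => ?_⟩
    · have h : {v : Fin T → ℝ | t ∈ if ∑ t ∈ σ v, v t ≤ ∑ t ∈ a, v t then a else σ v} =
          ({v | ∑ t ∈ σ v, v t ≤ ∑ t ∈ a, v t} ∩ {_v | t ∈ a}) ∪
          ({v | ∑ t ∈ σ v, v t ≤ ∑ t ∈ a, v t}ᶜ ∩ {v | t ∈ σ v}) := by
        ext v
        by_cases h : ∑ t ∈ σ v, v t ≤ ∑ t ∈ a, v t <;> simp [h, -not_le]
      rw [h]
      exact (hB.inter (MeasurableSet.const _)).union (hB.compl.inter (hσ t))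
    · beta_reduce
      split_ifs
      · exact Finset.mem_cons_self _ _
      · exact Finset.mem_cons_of_mem (hmem v)
    · beta_reduce
      rcases Finset.mem_cons.1 hS with rfl | hS
      · split_ifs with h
        · exact le_rfl
        · exact (not_le.1 h).le
      · split_ifs with h
        · exact (hmax v S hS).trans h
        · exact hmax v S hS

section ComonotoneLaw

variable {T : ℕ} (F : Fin T → Measure ℝ) (x : Fin T → ℝ) (q : Finset (Fin T) → ℝ)

open Classical in
/-- The valuations driven by a common uniform variable `u`: the agents in `S` draw from their top
quantiles, the others from their bottom quantiles. -/
noncomputable def comonotoneValuation (S : Finset (Fin T)) (u : ℝ) (t : Fin T) : ℝ :=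
  if t ∈ S then quantile (F t) (1 - x t + x t * u) else quantile (F t) (0 + (1 - x t) * u)

/-- The law of the valuations when `S` is drawn with probability `q S`, and the agents in `S` draw
from their top quantiles. -/
noncomputable def comonotoneLaw : Measure (Fin T → ℝ) :=
  ∑ S, ENNReal.ofReal (q S) •
    (volume.restrict (Set.Ioc (0 : ℝ) 1)).map (comonotoneValuation F x S)

variable [∀ t, IsProbabilityMeasure (F t)]

theorem measurable_comonotoneValuation (S : Finset (Fin T)) :
    Measurable (comonotoneValuation F x S) := by
  refine measurable_pi_iff.2 fun t => ?_
  unfold comonotoneValuation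
  have := measurable_quantile (F t)
  split_ifs
  · exact this.comp (by fun_prop)
  · exact this.comp (by fun_prop)

variable {x q}

open Classical in
-- Agent `t` is in the drawn set with probability `x t`, exactly the length of her top quantile
-- interval, so the top and bottom pieces reassemble the uniform law on (0, 1].
theorem map_comonotoneLaw (hq0 : ∀ S, 0 ≤ q S) (hq1 : ∑ S, q S = 1)
    (hx : ∀ t, ∑ S with t ∈ S, q S = x t) (t : Fin T) :
    (comonotoneLaw F x q).map (fun v => v t) = F t := by
  have hQ := measurable_quantile (F t)
  have hx0 : 0 ≤ x t := hx t ▸ Finset.sum_nonneg fun S _ => hq0 S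
  have hx' : ∑ S with t ∉ S, q S = 1 - x t := by
    rw [← hx t, ← hq1, ← Finset.sum_filter_add_sum_filter_not Finset.univ (t ∈ ·) q]; ring
  have hx1 : 0 ≤ 1 - x t := hx' ▸ Finset.sum_nonneg fun S _ => hq0 S
  rw [comonotoneLaw, ← Measure.mapₗ_apply_of_measurable (measurable_pi_apply t), map_sum]
  simp only [Measure.mapₗ_apply_of_measurable (measurable_pi_apply t), Measure.map_smul]
  have hcomp : ∀ S, ((volume.restrict (Set.Ioc (0 : ℝ) 1)).map (comonotoneValuation F x S)).map
      (fun v => v t) = (volume.restrict (Set.Ioc (0 : ℝ) 1)).map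
        fun u => comonotoneValuation F x S u t := fun S =>
    Measure.map_map (measurable_pi_apply t) (measurable_comonotoneValuation F x S)
  have htop : ∀ S ∈ Finset.univ.filter (t ∈ ·), ENNReal.ofReal (q S) •
      ((volume.restrict (Set.Ioc (0 : ℝ) 1)).map (comonotoneValuation F x S)).map (fun v => v t) =
      ENNReal.ofReal (q S) • (((volume.restrict (Set.Ioc (0 : ℝ) 1)).map
        fun u => 1 - x t + x t * u).map (quantile (F t))) := by
    intro S hS
    rw [hcomp, Measure.map_map hQ (by fun_prop)]
    simp only [comonotoneValuation, if_pos (Finset.mem_filter.1 hS).2]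
    rfl
  have hbot : ∀ S ∈ Finset.univ.filter (t ∉ ·), ENNReal.ofReal (q S) •
      ((volume.restrict (Set.Ioc (0 : ℝ) 1)).map (comonotoneValuation F x S)).map (fun v => v t) =
      ENNReal.ofReal (q S) • (((volume.restrict (Set.Ioc (0 : ℝ) 1)).map
        fun u => 0 + (1 - x t) * u).map (quantile (F t))) := by
    intro S hS
    rw [hcomp, Measure.map_map hQ (by fun_prop)]
    simp only [comonotoneValuation, if_neg (Finset.mem_filter.1 hS).2]
    rfl
  rw [← Finset.sum_filter_add_sum_filter_not Finset.univ (t ∈ ·), Finset.sum_congr rfl htop,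
    Finset.sum_congr rfl hbot, ← Finset.sum_smul, ← Finset.sum_smul,
    ← ENNReal.ofReal_sum_of_nonneg fun S _ => hq0 S,
    ← ENNReal.ofReal_sum_of_nonneg fun S _ => hq0 S, hx, hx',
    ← Measure.map_smul (f := quantile (F t)), ← Measure.map_smul (f := quantile (F t)),
    smul_map_affine_restrict_Ioc _ hx0, smul_map_affine_restrict_Ioc _ hx1,
    ← Measure.map_add _ _ hQ, zero_add, sub_add_cancel, add_comm, ← Measure.restrict_union
      (Set.Ioc_disjoint_Ioc_of_le le_rfl) measurableSet_Ioc,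
    Set.Ioc_union_Ioc_eq_Ioc hx1 (by linarith), map_quantile]

end ComonotoneLaw

theorem Prophet.integrable_value {T : ℕ} {M : Matroid (Fin T)} {G : SimpleGraph (Fin T)}
    {F : Fin T → Measure ℝ} (P : Prophet M G F) (hint : ∀ t, Integrable (fun a : ℝ => a) (F t)) :
    Integrable (fun v => ∑ t ∈ P.select v, v t) P.law := by
  refine (integrable_finsetSum Finset.univ fun t _ =>
    (P.integrable_eval hint t).indicator (P.measurable_select t)).congr (ae_of_all _ fun v => ?_)
  simp [Set.indicator_apply, Finset.sum_ite_mem]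

section Optimum

variable {T : ℕ} {M : Matroid (Fin T)} {G : SimpleGraph (Fin T)} {F : Fin T → Measure ℝ}
  [∀ t, IsProbabilityMeasure (F t)]

/-- Any lottery over feasible sets is matched by a prophet who realizes the top quantiles. -/
theorem exists_prophet_ge_of_lottery (hint : ∀ t, Integrable (fun a : ℝ => a) (F t))
    {x : Fin T → ℝ} {q : Finset (Fin T) → ℝ} (hq0 : ∀ S, 0 ≤ q S) (hq1 : ∑ S, q S = 1)
    (hfeas : ∀ S, q S ≠ 0 → Feasible M G S) (hx : ∀ t, ∑ S with t ∈ S, q S = x t) :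
    ∃ P : Prophet M G F, ∑ t, ∫ u in (1 - x t)..1, quantile (F t) u ≤ P.welfare := by
  classical
  -- A selection rule sees the valuations, not the drawn set; choosing a best feasible set does at
  -- least as well as the drawn one.
  obtain ⟨σ, hσ, hmem, hmax⟩ := exists_measurable_argmax
    (s := Finset.univ.filter fun S : Finset (Fin T) => Feasible M G S)
    ⟨∅, Finset.mem_filter.2 ⟨Finset.mem_univ _, feasible_empty M G⟩⟩
  have hprob : IsProbabilityMeasure (comonotoneLaw F x q) := by
    have : IsProbabilityMeasure (volume.restrict (Set.Ioc (0 : ℝ) 1)) := ⟨by simp⟩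
    refine ⟨?_⟩
    have h : ∀ S, (volume.restrict (Set.Ioc (0 : ℝ) 1)).map (comonotoneValuation F x S)
        Set.univ = 1 := fun S => by
      rw [Measure.map_apply (measurable_comonotoneValuation F x S) MeasurableSet.univ]
      simp
    simp only [comonotoneLaw, Measure.coe_finsetSum, Finset.sum_apply, Measure.smul_apply, h,
      smul_eq_mul, mul_one]
    rw [← ENNReal.ofReal_sum_of_nonneg fun S _ => hq0 S, hq1, ENNReal.ofReal_one]
  let P : Prophet M G F :=
    { law := comonotoneLaw F x q
      isProbabilityMeasure := hprob
      marginal := map_comonotoneLaw F hq0 hq1 hx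
      select := σ
      measurable_select := hσ
      feasible := fun v => (Finset.mem_filter.1 (hmem v)).2 }
  refine ⟨P, ?_⟩
  have hev : ∀ t S, Integrable (fun v : Fin T → ℝ => v t) (ENNReal.ofReal (q S) •
      (volume.restrict (Set.Ioc (0 : ℝ) 1)).map (comonotoneValuation F x S)) := fun t S =>
    integrable_finsetSum_measure.1 (P.integrable_eval hint t) S (Finset.mem_univ S)
  have hval := integrable_finsetSum_measure.1 (P.integrable_value hint)
  have hterm : ∀ t, ∀ S ∈ Finset.univ.filter fun S : Finset (Fin T) => t ∈ S,
      ∫ v, v t ∂(ENNReal.ofReal (q S) •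
        (volume.restrict (Set.Ioc (0 : ℝ) 1)).map (comonotoneValuation F x S)) =
      q S * ∫ u in (0 : ℝ)..1, quantile (F t) (1 - x t + x t * u) := by
    intro t S hS
    rw [integral_smul_measure, ENNReal.toReal_ofReal (hq0 S), smul_eq_mul,
      integral_map (measurable_comonotoneValuation F x S).aemeasurable
        (measurable_pi_apply t).aestronglyMeasurable,
      intervalIntegral.integral_of_le zero_le_one]
    simp only [comonotoneValuation, if_pos (Finset.mem_filter.1 hS).2]
  calc ∑ t, ∫ u in (1 - x t)..1, quantile (F t) u
      = ∑ t, ∑ S with t ∈ S, ∫ v, v t ∂(ENNReal.ofReal (q S) •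
        (volume.restrict (Set.Ioc (0 : ℝ) 1)).map (comonotoneValuation F x S)) := by
        refine Finset.sum_congr rfl fun t _ => ?_
        rw [Finset.sum_congr rfl (hterm t), ← Finset.sum_mul, hx,
          intervalIntegral.mul_integral_comp_add_mul]
        simp
    _ = ∑ S, ∫ v, ∑ t ∈ S, v t ∂(ENNReal.ofReal (q S) •
        (volume.restrict (Set.Ioc (0 : ℝ) 1)).map (comonotoneValuation F x S)) := by
        simp_rw [Finset.sum_filter]
        rw [Finset.sum_comm]
        refine Finset.sum_congr rfl fun S _ => ?_
        rw [integral_finsetSum _ fun t _ => hev t S, Finset.sum_ite_mem, Finset.univ_inter]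
    _ ≤ ∑ S, ∫ v, ∑ t ∈ σ v, v t ∂(ENNReal.ofReal (q S) •
        (volume.restrict (Set.Ioc (0 : ℝ) 1)).map (comonotoneValuation F x S)) := by
        refine Finset.sum_le_sum fun S hS => ?_
        rcases eq_or_ne (q S) 0 with h | h
        · simp [h]
        · exact integral_mono (integrable_finsetSum _ fun t _ => hev t S) (hval S hS)
            fun v => hmax v S (Finset.mem_filter.2 ⟨hS, hfeas S h⟩)
    _ = P.welfare := (integral_finsetSum_measure hval).symm

/-- Some prophet has maximum welfare. -/
theorem exists_prophet_forall_welfare_le (hint : ∀ t, Integrable (fun a : ℝ => a) (F t)) :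
    ∃ P : Prophet M G F, ∀ P' : Prophet M G F, P'.welfare ≤ P.welfare := by
  classical
  set K : Set (Finset (Fin T) → ℝ) :=
    stdSimplex ℝ (Finset (Fin T)) ∩ {q | ∀ S, ¬ Feasible M G S → q S = 0}
  have hcompact : IsCompact K := by
    refine (isCompact_stdSimplex ℝ _).inter_right ?_
    simp only [Set.ofPred_forall]
    exact isClosed_iInter fun S => isClosed_iInter fun _ =>
      isClosed_eq (continuous_apply S) continuous_const
  have hne : K.Nonempty := by
    refine ⟨Pi.single ∅ 1, single_mem_stdSimplex ℝ ∅, fun S hS => Pi.single_eq_of_ne ?_ _⟩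
    rintro rfl
    exact hS (feasible_empty M G)
  -- Each term is a primitive of an integrable function evaluated at a linear function of `q`.
  have hcont : Continuous fun q : Finset (Fin T) → ℝ =>
      ∑ t, ∫ u in (1 - ∑ S with t ∈ S, q S)..1, quantile (F t) u := by
    refine continuous_finsetSum _ fun t _ => ?_
    have h := intervalIntegral.continuous_primitive (μ := volume) (f := quantile (F t))
      (fun a b => (integrable_quantile (hint t)).intervalIntegrable) 1
    simp_rw [fun a : ℝ => intervalIntegral.integral_symm (μ := volume) (f := quantile (F t)) 1 a]
    exact (h.comp (by fun_prop)).neg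
  obtain ⟨q, ⟨hq, hqf⟩, hmax⟩ := hcompact.exists_isMaxOn hne hcont.continuousOn
  obtain ⟨P, hP⟩ := exists_prophet_ge_of_lottery (M := M) (G := G) hint hq.1 hq.2
    (fun S => not_imp_comm.1 (hqf S)) fun _ => rfl
  refine ⟨P, fun P' => ?_⟩
  rw [P'.welfare_eq hint]
  refine (Finset.sum_le_sum fun t _ => P'.x_mul_y_le hint t).trans (le_trans ?_ hP)
  have h := hmax (show P'.lottery ∈ K from ⟨⟨P'.lottery_nonneg, P'.sum_lottery⟩,
    fun S => not_imp_comm.1 P'.feasible_of_lottery_ne_zero⟩)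
  simpa only [Set.mem_ofPred_eq, P'.lottery_marginal] using h

end Optimum

theorem theorem1 (T : ℕ) (M : Matroid (Fin T)) (hM : M.E = Set.univ) (G : SimpleGraph (Fin T))
    (F : Fin T → Measure ℝ) (hprob : ∀ t, IsProbabilityMeasure (F t))
    (hint : ∀ t, Integrable (fun a : ℝ => a) (F t)) :
    IsGreatest (Set.range (Prophet.welfare : Prophet M G F → ℝ)) (OPT M G F) ∧
    (∃ A : OnlineAlgorithm M G,
      OPT M G F / (((d₁ M : ℝ) + 1) * ((d₂ G : ℝ) + 1)) ≤ A.welfare F) ∧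
    (∀ P : Prophet M G F,
      (∃ q : Finset (Fin T) → ℝ, IsIndepLottery M P.x q) ∧
      ∀ q : Finset (Fin T) → ℝ, IsIndepLottery M P.x q →
        ∃ A : OnlineAlgorithm M G, A.select = thresholdSelect M G P.x P.y q ∧
          P.welfare / (((d₁ M : ℝ) + 1) * ((d₂ G : ℝ) + 1)) ≤ A.welfare F) := by
  obtain ⟨P, hP⟩ := exists_prophet_forall_welfare_le (M := M) (G := G) hint
  have hgr : IsGreatest (Set.range (Prophet.welfare : Prophet M G F → ℝ)) P.welfare :=
    ⟨⟨P, rfl⟩, by rintro _ ⟨P', rfl⟩; exact hP P'⟩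
  have hOPT : OPT M G F = P.welfare := hgr.csSup_eq
  rw [hOPT]
  exact ⟨hgr, ⟨_, P.le_welfare_thresholdAlgorithm hint P.isIndepLottery⟩, fun P' =>
    ⟨⟨_, P'.isIndepLottery⟩, fun q hq => ⟨thresholdAlgorithm M G P'.x P'.y q, rfl,
      P'.le_welfare_thresholdAlgorithm hint hq⟩⟩⟩
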